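/- **Conventions.** For a real Banach lattice $X$, its complexification $X_{\mathbb C}=X\oplus iX$ carries the modulus $|x+iy|=\sup_{\theta\in[0,2\pi]}(x\cos\theta+y\sin\theta)\in X$ (this supremum exists) and the norm $\|x+iy\|=\|\,|x+iy|\,\|_X$; the spaces $X_{\mathbb C}$ are the complex Banach lattices. A lattice homomorphism $X_{\mathbb C}\to Y_{\mathbb C}$ is a map $x+iy\mapsto Sx+iSy$ with $S:X\to Y$ a real linear lattice homomorphism. An operator is a bounded linear map. For a real Banach space $F$ let $H_1[F]$ be the space of positively homogeneous functions $f:F^*\to\mathbb R$ with $$\|f\|_{\mathrm{FBL}[F]}=\sup\Big\{\sum_{i=1}^n|f(x_i^*)| : n\in\mathbb N,\ x_1^*,\dots,x_n^*\in F^*,\ \sup_{x\in B_F}\sum_{i=1}^n|x_i^*(x)|\le 1\Big\}<\infty,$$ with the pointwise order, and let $\mathrm{FBL}[F]$ be the closed vector sublattice of $H_1[F]$ generated by the evaluations $\delta_F(x)(x^*)=x^*(x)$, $x\in F$. Let $E$ be a complex Banach space, let $E_{\mathbb R}$ be $E$ regarded as a real Banach space, and endow the vector lattice $\mathrm{FBL}[E_{\mathbb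 R}]$ with $$\|f\|_{\mathrm{FBL}_{\mathbb C}[E]}=\sup\Big\{\sum_{j=1}^m|f(\mathrm{Re}\,z_j^*)| : m\in\mathbb N,\ z_1^*,\dots,z_m^*\in E^*,\ \sup_{z\in B_E}\sum_{j=1}^m|z_j^*(z)|\le 1\Big\}.$$ With this norm $\mathrm{FBL}[E_{\mathbb R}]$ is a real Banach lattice. Let $\mathrm{FBL}_{\mathbb C}[E]=\mathrm{FBL}[E_{\mathbb R}]\oplus i\,\mathrm{FBL}[E_{\mathbb R}]$ be its complexification, and let $\delta_E(z)=\delta_{E_{\mathbb R}}(z)-i\,\delta_{E_{\mathbb R}}(iz)$ for $z\in E$. **Theorem.** The norm of $f=f_1+if_2\in\mathrm{FBL}_{\mathbb C}[E]$ is given by the last displayed formula, with $f(x^*)=f_1(x^*)+if_2(x^*)\in\mathbb C$; and the complex Banach lattice $\mathrm{FBL}_{\mathbb C}[E]$ together with $\delta_E$ is the free complex Banach lattice generated by $E$. That is, $\delta_E:E\to\mathrm{FBL}_{\mathbb C}[E]$ is a $\mathbb C$-linear isometric embedding, and for every complex Banach lattice $X_{\mathbb C}$ and every $\mathbb C$-linear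 operator $T:E\to X_{\mathbb C}$ there is a unique lattice homomorphism $\hat T:\mathrm{FBL}_{\mathbb C}[E]\to X_{\mathbb C}$ with $\hat T\circ\delta_E=T$; moreover $\hat T$ is bounded and $\|\hat T\|=\|T\|$. -/

import Mathlib

open scoped ENNReal

universe u v w

/-! ### Complexification of a real Banach lattice -/

section Modulus

variable {X : Type*} [NormedAddCommGroup X] [NormedSpace ℝ X] [Lattice X]

/-- The set `{x cos θ + y sin θ : θ ∈ [0, 2π]}`, whose supremum is the modulus of `x + i y`. -/
def rotations (x y : X) : Set X :=
  (fun θ : ℝ => Real.cos θ • x + Real.sin θ • y) '' Set.Icc 0 (2 * Real.pi)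

variable [IsOrderedModule ℝ X]

theorem smul_le_abs_smul_abs (a : ℝ) (x : X) : a • x ≤ |a| • |x| := by
  rcases le_total 0 a with h | h
  · rw [abs_of_nonneg h]
    exact smul_le_smul_of_nonneg_left (le_abs_self x) h
  · rw [abs_of_nonpos h]
    have := smul_le_smul_of_nonneg_left (neg_le_abs x) (neg_nonneg.2 h)
    simpa using this

variable [IsOrderedAddMonoid X]

theorem rotation_le (x y : X) (θ τ : ℝ) :
    Real.cos θ • x + Real.sin θ • y
      ≤ (Real.cos τ • x + Real.sin τ • y) + |θ - τ| • (|x| + |y|) := by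
  have h1 : (Real.cos θ - Real.cos τ) • x ≤ |θ - τ| • |x| :=
    (smul_le_abs_smul_abs _ _).trans
      (smul_le_smul_of_nonneg_right (Real.abs_cos_sub_cos_le θ τ) (abs_nonneg x))
  have h2 : (Real.sin θ - Real.sin τ) • y ≤ |θ - τ| • |y| :=
    (smul_le_abs_smul_abs _ _).trans
      (smul_le_smul_of_nonneg_right (Real.abs_sin_sub_sin_le θ τ) (abs_nonneg y))
  have h3 := add_le_add h1 h2
  have h4 := add_le_add_right h3 (Real.cos τ • x + Real.sin τ • y)
  refine le_trans (le_of_eq ?_) (h4.trans (le_of_eq ?_)) <;> module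

variable [HasSolidNorm X] [CompleteSpace X]

/-- In a real Banach lattice the supremum that defines the modulus exists. -/
theorem exists_isLUB_rotations (x y : X) : ∃ m : X, IsLUB (rotations x y) m := by
  set u : X := |x| + |y| with hu
  have hu0 : 0 ≤ u := add_nonneg (abs_nonneg x) (abs_nonneg y)
  set f : ℝ → X := fun θ => Real.cos θ • x + Real.sin θ • y with hf
  set c : ℕ → ℝ := fun n => 2 * Real.pi / (n + 1) with hc
  have hpi := Real.pi_pos
  have hc0 : ∀ n, 0 ≤ c n := fun n => by positivity
  set s : ℕ → X := fun n =>
    (Finset.range (n + 2)).sup' ⟨0, by simp⟩ (fun k : ℕ => f (c n * k)) with hs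
  have key : ∀ n, ∀ θ ∈ Set.Icc 0 (2 * Real.pi), f θ ≤ s n + c n • u := by
    intro n θ hθ
    have hcn : 0 < c n := by positivity
    have hle : ⌊θ / c n⌋₊ ≤ n + 1 := by
      have h1 : θ / c n ≤ ((n + 1 : ℕ) : ℝ) := by
        rw [div_le_iff₀ hcn, hc]
        have : ((n + 1 : ℕ) : ℝ) * (2 * Real.pi / (n + 1)) = 2 * Real.pi := by
          push_cast
          field_simp
        simp only [this]
        exact hθ.2
      have := Nat.floor_mono h1
      rwa [Nat.floor_natCast] at this
    have h2 : |θ - c n * (⌊θ / c n⌋₊ : ℝ)| ≤ c n := by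
      have ha := Nat.floor_le (div_nonneg hθ.1 hcn.le)
      have hb := (Nat.lt_floor_add_one (θ / c n)).le
      rw [le_div_iff₀ hcn] at ha
      rw [div_le_iff₀ hcn] at hb
      rw [abs_le]
      constructor <;> nlinarith
    have h3 : f (c n * (⌊θ / c n⌋₊ : ℝ)) ≤ s n :=
      Finset.le_sup' (fun k : ℕ => f (c n * k)) (by simp; omega)
    exact (rotation_le x y θ _).trans
      (add_le_add h3 (smul_le_smul_of_nonneg_right h2 hu0))
  have mem : ∀ n k : ℕ, k ∈ Finset.range (n + 2) → c n * k ∈ Set.Icc 0 (2 * Real.pi) := by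
    intro n k hk
    have hk' : (k : ℝ) ≤ n + 1 := by
      have : k ≤ n + 1 := by
        have := Finset.mem_range.1 hk
        omega
      exact_mod_cast this
    refine ⟨mul_nonneg (hc0 n) (Nat.cast_nonneg k), ?_⟩
    calc c n * k ≤ c n * (n + 1) := mul_le_mul_of_nonneg_left hk' (hc0 n)
      _ = 2 * Real.pi := by
        simp only [hc]
        field_simp
  have low : ∀ n, ∀ b ∈ upperBounds (rotations x y), s n ≤ b := fun n b hb =>
    Finset.sup'_le _ _ fun k hk => hb ⟨c n * k, mem n k hk, rfl⟩
  have cmp : ∀ m n, s m ≤ s n + c n • u := fun m n =>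
    Finset.sup'_le _ _ fun k hk => key n _ (mem m k hk)
  have dst : ∀ m n, ‖s m - s n‖ ≤ (c m + c n) * ‖u‖ := by
    intro m n
    have hpos : 0 ≤ (c m + c n) • u := smul_nonneg (add_nonneg (hc0 m) (hc0 n)) hu0
    have h : |s m - s n| ≤ |(c m + c n) • u| := by
      rw [abs_of_nonneg hpos, add_smul]
      refine abs_le'.2 ⟨?_, ?_⟩
      · rw [sub_le_iff_le_add]
        refine (cmp m n).trans ?_
        have := smul_nonneg (hc0 m) hu0
        calc s n + c n • u ≤ s n + c n • u + c m • u := le_add_of_nonneg_right this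
          _ = c m • u + c n • u + s n := by abel
      · rw [neg_sub, sub_le_iff_le_add]
        refine (cmp n m).trans ?_
        have := smul_nonneg (hc0 n) hu0
        calc s m + c m • u ≤ s m + c m • u + c n • u := le_add_of_nonneg_right this
          _ = c m • u + c n • u + s m := by abel
    have := HasSolidNorm.solid h
    rwa [norm_smul, Real.norm_of_nonneg (add_nonneg (hc0 m) (hc0 n))] at this
  have clim : Filter.Tendsto c Filter.atTop (nhds 0) := by
    have h := (tendsto_one_div_add_atTop_nhds_zero_nat (𝕜 := ℝ)).const_mul (2 * Real.pi)
    rw [mul_zero] at h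
    refine h.congr fun n => ?_
    simp only [hc]
    ring
  have cau : CauchySeq s := by
    have anti : ∀ N n, N ≤ n → c n ≤ c N := by
      intro N n h
      have : (N : ℝ) ≤ n := by exact_mod_cast h
      simp only [hc]
      gcongr
    refine cauchySeq_of_le_tendsto_0 (fun N => 2 * c N * ‖u‖) ?_ ?_
    · intro n m N hn hm
      rw [dist_eq_norm]
      refine (dst n m).trans ?_
      have h1 := anti N n hn
      have h2 := anti N m hm
      gcongr
      linarith
    · have := (clim.const_mul 2).mul_const ‖u‖
      simpa using this
  obtain ⟨l, hl⟩ := cauchySeq_tendsto_of_complete cau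
  have hl' : Filter.Tendsto (fun n => s n + c n • u) Filter.atTop (nhds l) := by
    have := hl.add (clim.smul_const u)
    simpa using this
  refine ⟨l, ?_, fun b hb => le_of_tendsto' hl fun n => low n b hb⟩
  rintro _ ⟨θ, hθ, rfl⟩
  exact ge_of_tendsto' hl' fun n => key n θ hθ

end Modulus

/-- The complexification `X ⊕ iX` of a real vector space `X`; the pair `(re, im)` stands for
`re + i im`. -/
@[ext]
structure Complexification (X : Type*) where
  re : X
  im : X

namespace Complexification

section Algebra

variable {X : Type*} [AddCommGroup X]

instance : Zero (Complexification X) := ⟨⟨0, 0⟩⟩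
instance : Add (Complexification X) := ⟨fun z w => ⟨z.re + w.re, z.im + w.im⟩⟩
instance : Neg (Complexification X) := ⟨fun z => ⟨-z.re, -z.im⟩⟩

@[simp] theorem zero_re : (0 : Complexification X).re = 0 := rfl
@[simp] theorem zero_im : (0 : Complexification X).im = 0 := rfl
@[simp] theorem add_re (z w : Complexification X) : (z + w).re = z.re + w.re := rfl
@[simp] theorem add_im (z w : Complexification X) : (z + w).im = z.im + w.im := rfl
@[simp] theorem neg_re (z : Complexification X) : (-z).re = -z.re := rfl
@[simp] theorem neg_im (z : Complexification X) : (-z).im = -z.im := rfl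
variable [Module ℝ X]

/-- `(a + i b) (x + i y) = (a x - b y) + i (a y + b x)`. -/
instance : SMul ℂ (Complexification X) :=
  ⟨fun c z => ⟨c.re • z.re - c.im • z.im, c.re • z.im + c.im • z.re⟩⟩

@[simp] theorem smul_re (c : ℂ) (z : Complexification X) :
    (c • z).re = c.re • z.re - c.im • z.im := rfl
@[simp] theorem smul_im (c : ℂ) (z : Complexification X) :
    (c • z).im = c.re • z.im + c.im • z.re := rfl

instance : AddCommGroup (Complexification X) where
  add_assoc a b c := by ext <;> simp [add_assoc]
  zero_add a := by ext <;> simp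
  add_zero a := by ext <;> simp
  neg_add_cancel a := by ext <;> simp
  add_comm a b := by ext <;> simp [add_comm]
  nsmul := nsmulRec
  zsmul := zsmulRec

instance : Module ℂ (Complexification X) where
  one_smul z := by ext <;> simp
  mul_smul a b z := by
    ext
    · simp only [smul_re, smul_im, Complex.mul_re, Complex.mul_im]
      module
    · simp only [smul_re, smul_im, Complex.mul_re, Complex.mul_im]
      module
  smul_zero a := by ext <;> simp
  smul_add a z w := by
    ext
    · simp only [smul_re, add_re, add_im]
      module
    · simp only [smul_im, add_re, add_im]
      module
  add_smul a b z := by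
    ext
    · simp only [smul_re, add_re, Complex.add_re, Complex.add_im]
      module
    · simp only [smul_im, add_im, Complex.add_re, Complex.add_im]
      module
  zero_smul z := by ext <;> simp

end Algebra

section Norm

theorem norm_le_norm_of_nonneg {X : Type*} [NormedAddCommGroup X] [Lattice X]
    [IsOrderedAddMonoid X] [HasSolidNorm X] {a b : X} (ha : 0 ≤ a) (h : a ≤ b) : ‖a‖ ≤ ‖b‖ := by
  refine HasSolidNorm.solid ?_
  rwa [abs_of_nonneg ha, abs_of_nonneg (ha.trans h)]

variable {X : Type*} [NormedAddCommGroup X] [NormedSpace ℝ X] [Lattice X]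
  [IsOrderedAddMonoid X] [IsOrderedModule ℝ X] [HasSolidNorm X] [CompleteSpace X]

/-- The modulus `|x + i y| = sup {x cos θ + y sin θ : θ ∈ [0, 2π]}`, an element of `X`. -/
noncomputable def modulus (z : Complexification X) : X :=
  (exists_isLUB_rotations z.re z.im).choose

theorem isLUB_modulus (z : Complexification X) : IsLUB (rotations z.re z.im) z.modulus :=
  (exists_isLUB_rotations z.re z.im).choose_spec

theorem rotation_le_modulus (z : Complexification X) (θ : ℝ) :
    Real.cos θ • z.re + Real.sin θ • z.im ≤ z.modulus := by
  refine z.isLUB_modulus.1 ⟨toIcoMod Real.two_pi_pos 0 θ, ?_, ?_⟩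
  · have h := toIcoMod_mem_Ico Real.two_pi_pos 0 θ
    rw [zero_add] at h
    exact ⟨h.1, h.2.le⟩
  · have h : toIcoMod Real.two_pi_pos 0 θ
        = θ - toIcoDiv Real.two_pi_pos 0 θ * (2 * Real.pi) := by
      rw [toIcoMod, zsmul_eq_mul]
    simp only [h, Real.cos_sub_int_mul_two_pi, Real.sin_sub_int_mul_two_pi]

theorem modulus_le {z : Complexification X} {m : X}
    (h : ∀ θ : ℝ, Real.cos θ • z.re + Real.sin θ • z.im ≤ m) : z.modulus ≤ m := by
  refine z.isLUB_modulus.2 ?_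
  rintro _ ⟨θ, -, rfl⟩
  exact h θ

theorem abs_re_le_modulus (z : Complexification X) : |z.re| ≤ z.modulus := by
  refine abs_le'.2 ⟨?_, ?_⟩
  · simpa using z.rotation_le_modulus 0
  · simpa using z.rotation_le_modulus Real.pi

theorem abs_im_le_modulus (z : Complexification X) : |z.im| ≤ z.modulus := by
  refine abs_le'.2 ⟨?_, ?_⟩
  · simpa using z.rotation_le_modulus (Real.pi / 2)
  · simpa using z.rotation_le_modulus (-(Real.pi / 2))

theorem modulus_nonneg (z : Complexification X) : 0 ≤ z.modulus :=
  (abs_nonneg _).trans z.abs_re_le_modulus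

theorem modulus_add_le (z w : Complexification X) :
    (z + w).modulus ≤ z.modulus + w.modulus := by
  refine modulus_le fun θ => le_trans (le_of_eq ?_)
    (add_le_add (z.rotation_le_modulus θ) (w.rotation_le_modulus θ))
  simp only [add_re, add_im]
  module

theorem modulus_smul_le (c : ℂ) (z : Complexification X) :
    (c • z).modulus ≤ ‖c‖ • z.modulus := by
  refine modulus_le fun θ => le_trans (le_of_eq ?_)
    (smul_le_smul_of_nonneg_left (z.rotation_le_modulus (θ - c.arg)) (norm_nonneg c))
  have h1 := Complex.norm_mul_cos_arg c
  have h2 := Complex.norm_mul_sin_arg c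
  simp only [smul_re, smul_im, Real.cos_sub, Real.sin_sub]
  rw [← h1, ← h2]
  module

/-- The norm of a complex Banach lattice: `‖x + i y‖ = ‖ |x + i y| ‖`. -/
noncomputable instance : Norm (Complexification X) := ⟨fun z => ‖z.modulus‖⟩

theorem norm_def (z : Complexification X) : ‖z‖ = ‖z.modulus‖ := rfl

theorem norm_smul_le' (c : ℂ) (z : Complexification X) : ‖c • z‖ ≤ ‖c‖ * ‖z‖ := by
  have h := norm_le_norm_of_nonneg (modulus_nonneg _) (modulus_smul_le c z)
  rwa [norm_smul, norm_norm] at h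

theorem normedSpaceCore : NormedSpace.Core ℂ (Complexification X) where
  norm_nonneg z := norm_nonneg z.modulus
  norm_triangle z w :=
    (norm_le_norm_of_nonneg (modulus_nonneg _) (modulus_add_le z w)).trans (norm_add_le _ _)
  norm_smul c z := by
    rcases eq_or_ne c 0 with rfl | hc
    · have h := norm_smul_le' 0 z
      rw [norm_zero, zero_mul] at h ⊢
      exact le_antisymm h (norm_nonneg (modulus ((0 : ℂ) • z)))
    · refine le_antisymm (norm_smul_le' c z) ?_
      have h := norm_smul_le' c⁻¹ (c • z)
      rw [inv_smul_smul₀ hc, norm_inv] at h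
      have hc' : 0 < ‖c‖ := norm_pos_iff.2 hc
      calc ‖c‖ * ‖z‖ ≤ ‖c‖ * (‖c‖⁻¹ * ‖c • z‖) := mul_le_mul_of_nonneg_left h hc'.le
        _ = ‖c • z‖ := by field_simp
  norm_eq_zero_iff z := by
    constructor
    · intro h
      have hm : z.modulus = 0 := norm_eq_zero.1 h
      have h1 := z.abs_re_le_modulus
      have h2 := z.abs_im_le_modulus
      rw [hm] at h1 h2
      ext
      · exact le_antisymm ((le_abs_self _).trans h1) (neg_nonpos.1 ((neg_le_abs _).trans h1))
      · exact le_antisymm ((le_abs_self _).trans h2) (neg_nonpos.1 ((neg_le_abs _).trans h2))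
    · rintro rfl
      have h : (0 : Complexification X).modulus ≤ 0 := modulus_le fun θ => by simp
      rw [norm_def, le_antisymm h (modulus_nonneg _), norm_zero]

noncomputable instance : NormedAddCommGroup (Complexification X) :=
  NormedAddCommGroup.ofCore normedSpaceCore

noncomputable instance : NormedSpace ℂ (Complexification X) :=
  NormedSpace.ofCore normedSpaceCore

end Norm

/-- A lattice homomorphism between complex Banach lattices: the complexification of a (real)
lattice homomorphism. -/
def IsLatticeHom {X Y : Type*} [AddCommGroup X] [Module ℝ X] [Lattice X]
    [AddCommGroup Y] [Module ℝ Y] [Lattice Y]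
    (T : Complexification X →ₗ[ℂ] Complexification Y) : Prop :=
  ∃ S : X →ₗ[ℝ] Y, (∀ x y, S (x ⊔ y) = S x ⊔ S y) ∧ (∀ x y, S (x ⊓ y) = S x ⊓ S y) ∧
    ∀ z, T z = ⟨S z.re, S z.im⟩

end Complexification

/-! ### The free Banach lattice and its renorming -/

/-- The supremum of `∑ j, ‖f (φ j)‖` over all finite tuples `φ` that satisfy `P`. -/
noncomputable def tupleSup {D G : Type*} [Norm G] (P : ∀ m : ℕ, (Fin m → D) → Prop)
    (f : D → G) : ℝ≥0∞ :=
  ⨆ (m : ℕ) (φ : Fin m → D) (_ : P m φ), ENNReal.ofReal (∑ j, ‖f (φ j)‖)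

section TupleSup

variable {D G : Type*} [NormedAddCommGroup G] {P : ∀ m : ℕ, (Fin m → D) → Prop}

theorem le_tupleSup {m : ℕ} {φ : Fin m → D} (h : P m φ) (f : D → G) :
    ENNReal.ofReal (∑ j, ‖f (φ j)‖) ≤ tupleSup P f :=
  le_iSup₂_of_le m φ (le_iSup_of_le h le_rfl)

theorem tupleSup_le {f : D → G} {c : ℝ≥0∞}
    (h : ∀ m (φ : Fin m → D), P m φ → ENNReal.ofReal (∑ j, ‖f (φ j)‖) ≤ c) :
    tupleSup P f ≤ c :=
  iSup_le fun m => iSup₂_le fun φ hφ => h m φ hφ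

theorem tupleSup_zero : tupleSup P (0 : D → G) = 0 :=
  le_antisymm (tupleSup_le fun m φ _ => by simp) zero_le

theorem tupleSup_add_le (f g : D → G) : tupleSup P (f + g) ≤ tupleSup P f + tupleSup P g := by
  refine tupleSup_le fun m φ h => ?_
  calc ENNReal.ofReal (∑ j, ‖(f + g) (φ j)‖)
      ≤ ENNReal.ofReal (∑ j, ‖f (φ j)‖ + ∑ j, ‖g (φ j)‖) := by
        rw [← Finset.sum_add_distrib]
        exact ENNReal.ofReal_le_ofReal (Finset.sum_le_sum fun j _ => norm_add_le _ _)
    _ ≤ _ := ENNReal.ofReal_add_le.trans (add_le_add (le_tupleSup h f) (le_tupleSup h g))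

theorem tupleSup_mono {f g : D → G} (h : ∀ φ, ‖f φ‖ ≤ ‖g φ‖) : tupleSup P f ≤ tupleSup P g :=
  tupleSup_le fun _ _ hP =>
    (ENNReal.ofReal_le_ofReal (Finset.sum_le_sum fun _ _ => h _)).trans (le_tupleSup hP g)

theorem tupleSup_smul_le [NormedSpace ℝ G] (c : ℝ) (f : D → G) :
    tupleSup P (c • f) ≤ ENNReal.ofReal |c| * tupleSup P f := by
  refine tupleSup_le fun m φ h => ?_
  have : ∑ j, ‖(c • f) (φ j)‖ = |c| * ∑ j, ‖f (φ j)‖ := by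
    rw [Finset.mul_sum]
    exact Finset.sum_congr rfl fun j _ => by rw [Pi.smul_apply, norm_smul, Real.norm_eq_abs]
  rw [this, ENNReal.ofReal_mul (abs_nonneg c)]
  exact mul_le_mul_right (le_tupleSup h f) _

end TupleSup

section RealFBL

variable (F : Type*) [NormedAddCommGroup F] [NormedSpace ℝ F]

/-- The tuples of functionals over which the norm of `FBL[F]` is computed. -/
def IsAdmissible (𝕜 : Type*) [RCLike 𝕜] (F : Type*) [NormedAddCommGroup F] [NormedSpace 𝕜 F]
    (m : ℕ) (φ : Fin m → StrongDual 𝕜 F) : Prop :=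
  ∀ x : F, ‖x‖ ≤ 1 → ∑ j, ‖φ j x‖ ≤ 1

variable {F} in
/-- The norm of the free Banach lattice `FBL[F]` over a real space `F`, with value `∞` allowed. -/
noncomputable def fblNorm (f : StrongDual ℝ F → ℝ) : ℝ≥0∞ :=
  tupleSup (IsAdmissible ℝ F) f

/-- The space `H₁[F]` of positively homogeneous functions on the dual with finite norm. -/
noncomputable def H1 : Submodule ℝ (StrongDual ℝ F → ℝ) where
  carrier := {f | (∀ (c : ℝ) (φ : StrongDual ℝ F), 0 ≤ c → f (c • φ) = c * f φ) ∧ fblNorm f < ∞}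
  zero_mem' := by
    refine ⟨fun c φ _ => by simp, ?_⟩
    rw [fblNorm, tupleSup_zero]
    exact ENNReal.zero_lt_top
  add_mem' := by
    rintro f g ⟨hf, hf'⟩ ⟨hg, hg'⟩
    refine ⟨fun c φ hc => ?_, (tupleSup_add_le f g).trans_lt (ENNReal.add_lt_top.2 ⟨hf', hg'⟩)⟩
    simp only [Pi.add_apply, hf c φ hc, hg c φ hc, mul_add]
  smul_mem' := by
    rintro a f ⟨hf, hf'⟩
    refine ⟨fun c φ hc => ?_,
      (tupleSup_smul_le a f).trans_lt (ENNReal.mul_lt_top ENNReal.ofReal_lt_top hf')⟩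
    simp only [Pi.smul_apply, smul_eq_mul, hf c φ hc]
    ring

variable {F} in
/-- Closed vector sublattices of the Banach lattice `H₁[F]` (with pointwise order). -/
structure IsClosedSublattice (S : Submodule ℝ (StrongDual ℝ F → ℝ)) : Prop where
  le_H1 : S ≤ H1 F
  sup_mem : ∀ f ∈ S, ∀ g ∈ S, f ⊔ g ∈ S
  closed : ∀ f ∈ H1 F, (∀ ε : ℝ≥0∞, 0 < ε → ∃ g ∈ S, fblNorm (f - g) < ε) → f ∈ S

variable {F} in
/-- The evaluation function `δ_x`, `δ_x(x*) = x*(x)`. -/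
def evalFun (x : F) : StrongDual ℝ F → ℝ := fun φ => φ x

/-- The free Banach lattice `FBL[F]`: the closed sublattice of `H₁[F]` generated by the
evaluations `δ_x`. -/
noncomputable def FBL : Submodule ℝ (StrongDual ℝ F → ℝ) :=
  sInf {S | IsClosedSublattice S ∧ ∀ x : F, evalFun x ∈ S}

variable {F}

theorem evalFun_mem_FBL (x : F) : evalFun x ∈ FBL F :=
  (Submodule.mem_sInf).2 fun _ hS => hS.2 x

theorem evalFun_mem_H1 (x : F) : evalFun x ∈ H1 F := by
  refine ⟨fun c φ _ => by simp [evalFun], ?_⟩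
  refine lt_of_le_of_lt (tupleSup_le (c := ENNReal.ofReal (‖x‖ + 1)) fun m φ h => ?_)
    ENNReal.ofReal_lt_top
  refine ENNReal.ofReal_le_ofReal ?_
  have hx : 0 < ‖x‖ + 1 := by positivity
  have h1 := h ((‖x‖ + 1)⁻¹ • x) (by
    rw [norm_smul, Real.norm_of_nonneg (inv_nonneg.2 hx.le), inv_mul_le_iff₀ hx]
    linarith)
  have h2 : ∑ j, ‖φ j ((‖x‖ + 1)⁻¹ • x)‖ = (‖x‖ + 1)⁻¹ * ∑ j, ‖evalFun x (φ j)‖ := by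
    rw [Finset.mul_sum]
    refine Finset.sum_congr rfl fun j _ => ?_
    rw [map_smul, norm_smul, Real.norm_of_nonneg (inv_nonneg.2 hx.le)]
    rfl
  rw [h2, inv_mul_le_iff₀ hx, mul_one] at h1
  exact h1

theorem abs_sup_le_abs_add (a b : ℝ) : |a ⊔ b| ≤ ‖|a| + |b|‖ := by
  rw [Real.norm_of_nonneg (by positivity)]
  rcases max_cases a b with h | h <;> rw [h.1]
  · linarith [abs_nonneg b]
  · linarith [abs_nonneg a]

theorem isClosedSublattice_H1 : IsClosedSublattice (H1 F) where
  le_H1 := le_rfl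
  closed f hf _ := hf
  sup_mem := by
    rintro f ⟨hf, hf'⟩ g ⟨hg, hg'⟩
    constructor
    · intro c φ hc
      simp only [Pi.sup_apply, hf c φ hc, hg c φ hc]
      exact (mul_max_of_nonneg _ _ hc).symm
    · have h1 : fblNorm (f ⊔ g) ≤ fblNorm (|f| + |g|) :=
        tupleSup_mono fun φ => abs_sup_le_abs_add _ _
      have h2 : fblNorm |f| ≤ fblNorm f := tupleSup_mono fun φ => by simp
      have h3 : fblNorm |g| ≤ fblNorm g := tupleSup_mono fun φ => by simp
      exact (h1.trans ((tupleSup_add_le _ _).trans (add_le_add h2 h3))).trans_lt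
        (ENNReal.add_lt_top.2 ⟨hf', hg'⟩)

/-- `FBL[F]` is itself a closed sublattice of `H₁[F]`. -/
theorem isClosedSublattice_FBL : IsClosedSublattice (FBL F) where
  le_H1 := sInf_le ⟨isClosedSublattice_H1, evalFun_mem_H1⟩
  sup_mem f hf g hg := Submodule.mem_sInf.2 fun S hS =>
    hS.1.sup_mem f (Submodule.mem_sInf.1 hf S hS) g (Submodule.mem_sInf.1 hg S hS)
  closed f hf h := Submodule.mem_sInf.2 fun S hS => hS.1.closed f hf fun ε hε => by
    obtain ⟨g, hg, hg'⟩ := h ε hε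
    exact ⟨g, Submodule.mem_sInf.1 hg S hS, hg'⟩

theorem inf_mem_FBL {f g : StrongDual ℝ F → ℝ} (hf : f ∈ FBL F) (hg : g ∈ FBL F) :
    f ⊓ g ∈ FBL F := by
  have h := neg_mem (isClosedSublattice_FBL.sup_mem _ (neg_mem hf) _ (neg_mem hg))
  rwa [neg_sup, neg_neg, neg_neg] at h

end RealFBL

section Renorming

variable {E : Type*} [NormedAddCommGroup E] [NormedSpace ℂ E]

/-- The real part `Re z*` of a complex functional, a real functional on `E_ℝ`. -/
noncomputable def rePart (z : StrongDual ℂ E) : StrongDual ℝ E :=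
  Complex.reCLM.comp (z.restrictScalars ℝ)

@[simp] theorem rePart_apply (z : StrongDual ℂ E) (x : E) : rePart z x = (z x).re := rfl

/-- The supremum of `∑ j, ‖f (Re z_j*)‖` over tuples in `E*` with
`∑ j, |z_j*(z)| ≤ 1` for all `z` in the unit ball of `E`. -/
noncomputable def cfblNorm {G : Type*} [Norm G] (f : StrongDual ℝ E → G) : ℝ≥0∞ :=
  tupleSup (IsAdmissible ℂ E) (fun z => f (rePart z))

theorem exists_rePart (φ : StrongDual ℝ E) : ∃ z : StrongDual ℂ E, rePart z = φ := by
  refine ⟨φ.extendRCLike, ?_⟩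
  ext x
  exact StrongDual.re_extendRCLike_apply (𝕜 := ℂ) φ x

theorem cfblNorm_le (f : StrongDual ℝ E → ℝ) : cfblNorm f ≤ fblNorm f := by
  refine tupleSup_le fun m z h => le_tupleSup (φ := fun j => rePart (z j)) (fun x hx => ?_) f
  exact (Finset.sum_le_sum fun j _ => Complex.abs_re_le_norm (z j x)).trans (h x hx)

theorem fblNorm_le {f : StrongDual ℝ E → ℝ} (hf : f ∈ H1 E) : fblNorm f ≤ 2 * cfblNorm f := by
  refine tupleSup_le fun m φ h => ?_
  choose z hz using fun j => exists_rePart (φ j)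
  have hadm : IsAdmissible ℂ E m (fun j => ((1 / 2 : ℝ) : ℂ) • z j) := by
    intro x hx
    have h1 := h x hx
    have h2 := h ((-Complex.I) • x) (by simpa [norm_smul] using hx)
    calc ∑ j, ‖(((1 / 2 : ℝ) : ℂ) • z j) x‖
        ≤ ∑ j, (1 / 2) * (‖φ j x‖ + ‖φ j ((-Complex.I) • x)‖) := by
          refine Finset.sum_le_sum fun j _ => ?_
          have h3 := Complex.norm_le_abs_re_add_abs_im (z j x)
          rw [← hz j, rePart_apply, rePart_apply, map_smul, smul_apply,
            norm_smul, Complex.norm_real]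
          simp only [Real.norm_eq_abs]
          rw [abs_of_pos (by norm_num : (0 : ℝ) < 1 / 2)]
          simp at h3 ⊢
          linarith
      _ ≤ 1 := by
          rw [← Finset.mul_sum, Finset.sum_add_distrib]
          linarith
  have h4 := le_tupleSup hadm (fun z => f (rePart z))
  have h5 : ∀ j, f (rePart (((1 / 2 : ℝ) : ℂ) • z j)) = (1 / 2) * f (φ j) := by
    intro j
    rw [← hf.1 (1 / 2) (φ j) (by norm_num), ← hz j]
    congr 1
    ext x
    simp
  simp only [h5, norm_mul, ← Finset.mul_sum] at h4
  rw [ENNReal.ofReal_mul (norm_nonneg _)] at h4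
  calc ENNReal.ofReal (∑ j, ‖f (φ j)‖)
      = 2 * (ENNReal.ofReal ‖(1 / 2 : ℝ)‖ * ENNReal.ofReal (∑ j, ‖f (φ j)‖)) := by
        rw [← mul_assoc]
        have : (2 : ℝ≥0∞) * ENNReal.ofReal ‖(1 / 2 : ℝ)‖ = 1 := by
          rw [← ENNReal.ofReal_ofNat 2, ← ENNReal.ofReal_mul (by norm_num)]
          norm_num
        rw [this, one_mul]
    _ ≤ _ := mul_le_mul_right h4 _

theorem cfblNorm_ne_top {f : StrongDual ℝ E → ℝ} (hf : f ∈ FBL E) : cfblNorm f ≠ ∞ :=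
  ((cfblNorm_le f).trans_lt (isClosedSublattice_FBL.le_H1 hf).2).ne

theorem abs_apply_le {f : StrongDual ℝ E → ℝ} (hf : f ∈ FBL E) (φ : StrongDual ℝ E) :
    |f φ| ≤ (‖φ‖ + 1) * (cfblNorm f).toReal := by
  obtain ⟨z, hz, hn⟩ : ∃ z : StrongDual ℂ E, rePart z = φ ∧ ‖z‖ = ‖φ‖ := by
    refine ⟨φ.extendRCLike, ?_, StrongDual.norm_extendRCLike φ⟩
    ext x
    exact StrongDual.re_extendRCLike_apply (𝕜 := ℂ) φ x
  have hc : 0 < ‖φ‖ + 1 := by positivity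
  have hadm : IsAdmissible ℂ E 1 (fun _ => (((‖φ‖ + 1)⁻¹ : ℝ) : ℂ) • z) := by
    intro x hx
    rw [Fin.sum_univ_one, smul_apply, norm_smul, Complex.norm_real,
      Real.norm_of_nonneg (inv_nonneg.2 hc.le), inv_mul_le_iff₀ hc]
    have := z.le_opNorm x
    have h2 : ‖z‖ * ‖x‖ ≤ ‖z‖ * 1 := mul_le_mul_of_nonneg_left hx (norm_nonneg _)
    linarith
  have h : _ ≤ cfblNorm f := le_tupleSup hadm (fun z => f (rePart z))
  have h5 : f (rePart ((((‖φ‖ + 1)⁻¹ : ℝ) : ℂ) • z)) = (‖φ‖ + 1)⁻¹ * f φ := by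
    rw [← (isClosedSublattice_FBL.le_H1 hf).1 _ φ (inv_nonneg.2 hc.le)]
    congr 1
    ext x
    simp only [rePart_apply, smul_apply, smul_eq_mul, Complex.re_ofReal_mul, ← hz]
  rw [Fin.sum_univ_one, h5, norm_mul, Real.norm_of_nonneg (inv_nonneg.2 hc.le),
    ENNReal.ofReal_le_iff_le_toReal (cfblNorm_ne_top hf), inv_mul_le_iff₀ hc] at h
  exact h

variable (E) in
/-- The vector lattice `FBL[E_ℝ]`, to be endowed with the norm `‖·‖_{FBL_ℂ[E]}`. -/
def RenormedFBL : Type _ := FBL E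

namespace RenormedFBL

noncomputable instance : AddCommGroup (RenormedFBL E) := inferInstanceAs (AddCommGroup (FBL E))
noncomputable instance : Module ℝ (RenormedFBL E) := inferInstanceAs (Module ℝ (FBL E))

instance : CoeFun (RenormedFBL E) (fun _ => StrongDual ℝ E → ℝ) := ⟨Subtype.val⟩

/-- Pointwise order and lattice operations. -/
noncomputable instance : Lattice (RenormedFBL E) where
  le f g := f.1 ≤ g.1
  le_refl f := le_refl f.1
  le_trans f g h := le_trans (a := f.1) (b := g.1) (c := h.1)
  le_antisymm f g h h' := Subtype.ext (le_antisymm (a := f.1) (b := g.1) h h')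
  sup f g := ⟨f.1 ⊔ g.1, isClosedSublattice_FBL.sup_mem _ f.2 _ g.2⟩
  inf f g := ⟨f.1 ⊓ g.1, inf_mem_FBL f.2 g.2⟩
  le_sup_left f g := le_sup_left (a := f.1) (b := g.1)
  le_sup_right f g := le_sup_right (a := f.1) (b := g.1)
  sup_le f g h := sup_le (a := f.1) (b := g.1) (c := h.1)
  inf_le_left f g := inf_le_left (a := f.1) (b := g.1)
  inf_le_right f g := inf_le_right (a := f.1) (b := g.1)
  le_inf f g h := le_inf (c := f.1) (a := g.1) (b := h.1)

instance : IsOrderedAddMonoid (RenormedFBL E) where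
  add_le_add_left _ _ h k := add_le_add_left (α := StrongDual ℝ E → ℝ) h k.1

instance : IsOrderedModule ℝ (RenormedFBL E) where
  smul_le_smul_of_nonneg_left _ ha _ _ h := fun φ => mul_le_mul_of_nonneg_left (h φ) ha
  smul_le_smul_of_nonneg_right _ hf _ _ h := fun φ => mul_le_mul_of_nonneg_right h (hf φ)

noncomputable instance : Norm (RenormedFBL E) :=
  ⟨fun f => (cfblNorm (f : StrongDual ℝ E → ℝ)).toReal⟩

theorem norm_def (f : RenormedFBL E) : ‖f‖ = (cfblNorm (f : StrongDual ℝ E → ℝ)).toReal := rfl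

theorem ofReal_norm (f : RenormedFBL E) : ENNReal.ofReal ‖f‖ = cfblNorm f.1 :=
  ENNReal.ofReal_toReal (cfblNorm_ne_top f.2)

theorem norm_smul_le' (c : ℝ) (f : RenormedFBL E) : ‖c • f‖ ≤ ‖c‖ * ‖f‖ := by
  have h : cfblNorm (c • f.1) ≤ ENNReal.ofReal |c| * cfblNorm f.1 := tupleSup_smul_le c _
  have h2 := ENNReal.toReal_mono
    (ENNReal.mul_ne_top ENNReal.ofReal_ne_top (cfblNorm_ne_top f.2)) h
  rw [ENNReal.toReal_mul, ENNReal.toReal_ofReal (abs_nonneg c)] at h2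
  exact h2

theorem normedSpaceCore : NormedSpace.Core ℝ (RenormedFBL E) where
  norm_nonneg _ := ENNReal.toReal_nonneg
  norm_triangle f g := by
    have h : cfblNorm (f.1 + g.1) ≤ cfblNorm f.1 + cfblNorm g.1 := tupleSup_add_le _ _
    have h2 := ENNReal.toReal_mono
      (ENNReal.add_ne_top.2 ⟨cfblNorm_ne_top f.2, cfblNorm_ne_top g.2⟩) h
    rw [ENNReal.toReal_add (cfblNorm_ne_top f.2) (cfblNorm_ne_top g.2)] at h2
    exact h2
  norm_smul c f := by
    rcases eq_or_ne c 0 with rfl | hc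
    · have h := norm_smul_le' 0 f
      rw [norm_zero, zero_mul] at h ⊢
      exact le_antisymm h ENNReal.toReal_nonneg
    · refine le_antisymm (norm_smul_le' c f) ?_
      have h := norm_smul_le' c⁻¹ (c • f)
      rw [inv_smul_smul₀ hc, norm_inv] at h
      have hc' : 0 < ‖c‖ := norm_pos_iff.2 hc
      calc ‖c‖ * ‖f‖ ≤ ‖c‖ * (‖c‖⁻¹ * ‖c • f‖) := mul_le_mul_of_nonneg_left h hc'.le
        _ = ‖c • f‖ := by field_simp
  norm_eq_zero_iff f := by
    constructor
    · intro h
      refine Subtype.ext (funext fun φ => ?_)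
      have h1 := abs_apply_le f.2 φ
      rw [← norm_def, h, mul_zero] at h1
      exact abs_nonpos_iff.1 h1
    · rintro rfl
      have h : cfblNorm (0 : StrongDual ℝ E → ℝ) = 0 := tupleSup_zero
      change (cfblNorm (0 : StrongDual ℝ E → ℝ)).toReal = 0
      rw [h, ENNReal.toReal_zero]

noncomputable instance : NormedAddCommGroup (RenormedFBL E) :=
  NormedAddCommGroup.ofCore normedSpaceCore

noncomputable instance : NormedSpace ℝ (RenormedFBL E) :=
  NormedSpace.ofCore normedSpaceCore

instance : HasSolidNorm (RenormedFBL E) where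
  solid _ g h := ENNReal.toReal_mono (cfblNorm_ne_top g.2) (tupleSup_mono fun z => h (rePart z))

instance : CompleteSpace (RenormedFBL E) := by
  refine Metric.complete_of_cauchySeq_tendsto fun u hu => ?_
  have hsub : ∀ n m φ, |u n φ - u m φ| ≤ (‖φ‖ + 1) * ‖u n - u m‖ := fun n m φ =>
    abs_apply_le (u n - u m).2 φ
  have hpt : ∀ φ, ∃ l, Filter.Tendsto (fun n => u n φ) Filter.atTop (nhds l) := by
    intro φ
    refine cauchySeq_tendsto_of_complete (Metric.cauchySeq_iff.2 fun ε hε => ?_)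
    have hc : 0 < ‖φ‖ + 1 := by positivity
    obtain ⟨N, hN⟩ := Metric.cauchySeq_iff.1 hu (ε / (‖φ‖ + 1)) (by positivity)
    refine ⟨N, fun m hm n hn => ?_⟩
    have h1 := hN m hm n hn
    rw [dist_eq_norm, lt_div_iff₀ hc] at h1
    rw [Real.dist_eq]
    exact (hsub m n φ).trans_lt (by linarith)
  choose g hg using hpt
  have hnear : ∀ ε : ℝ, 0 < ε → ∃ N, ∀ n ≥ N, fblNorm (g - (u n).1) ≤ ENNReal.ofReal ε := by
    intro ε hε
    obtain ⟨N, hN⟩ := Metric.cauchySeq_iff.1 hu (ε / 2) (by positivity)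
    refine ⟨N, fun n hn => tupleSup_le fun m φ hφ => ENNReal.ofReal_le_ofReal ?_⟩
    have hlim : Filter.Tendsto (fun k => ∑ j, ‖u k (φ j) - u n (φ j)‖) Filter.atTop
        (nhds (∑ j, ‖(g - (u n).1) (φ j)‖)) :=
      tendsto_finsetSum _ fun j _ => ((hg (φ j)).sub_const _).norm
    refine le_of_tendsto hlim (Filter.eventually_atTop.2 ⟨N, fun k hk => ?_⟩)
    have h1 : ENNReal.ofReal (∑ j, ‖u k (φ j) - u n (φ j)‖) ≤ ENNReal.ofReal ε := by
      calc _ ≤ fblNorm (u k - u n).1 := le_tupleSup hφ (u k - u n).1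
        _ ≤ 2 * cfblNorm (u k - u n).1 :=
          fblNorm_le (isClosedSublattice_FBL.le_H1 (u k - u n).2)
        _ = ENNReal.ofReal (2 * ‖u k - u n‖) := by
          rw [← ofReal_norm, ENNReal.ofReal_mul (by norm_num), ENNReal.ofReal_ofNat]
        _ ≤ ENNReal.ofReal ε := by
          have := hN k hk n hn
          rw [dist_eq_norm] at this
          exact ENNReal.ofReal_le_ofReal (by linarith)
    exact (ENNReal.ofReal_le_ofReal_iff hε.le).1 h1
  have hH1 : g ∈ H1 E := by
    constructor
    · intro c φ hc
      refine tendsto_nhds_unique (hg (c • φ)) (((hg φ).const_mul c).congr fun n => ?_)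
      exact ((isClosedSublattice_FBL.le_H1 (u n).2).1 c φ hc).symm
    · obtain ⟨N, hN⟩ := hnear 1 one_pos
      have h1 := hN N le_rfl
      have h2 := tupleSup_add_le (P := IsAdmissible ℝ E) (g - (u N).1) (u N).1
      rw [sub_add_cancel] at h2
      exact (h2.trans (add_le_add_left h1 _)).trans_lt
        (ENNReal.add_lt_top.2 ⟨ENNReal.ofReal_lt_top, (isClosedSublattice_FBL.le_H1 (u N).2).2⟩)
  have hmem : g ∈ FBL E := by
    refine isClosedSublattice_FBL.closed g hH1 fun ε hε => ?_
    obtain ⟨r, hr, hr'⟩ := ENNReal.lt_iff_exists_real_btwn.1 hε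
    have hr0 : 0 < r := ENNReal.ofReal_pos.1 hr'.1
    obtain ⟨N, hN⟩ := hnear r hr0
    exact ⟨(u N).1, (u N).2, (hN N le_rfl).trans_lt hr'.2⟩
  let g' : RenormedFBL E := ⟨g, hmem⟩
  refine ⟨g', Metric.tendsto_atTop.2 fun ε hε => ?_⟩
  obtain ⟨N, hN⟩ := hnear (ε / 2) (by positivity)
  refine ⟨N, fun n hn => ?_⟩
  rw [dist_comm, dist_eq_norm]
  have h1 : cfblNorm (g - (u n).1) ≤ ENNReal.ofReal (ε / 2) := (cfblNorm_le _).trans (hN n hn)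
  have h2 : ‖g' - u n‖ ≤ ε / 2 :=
    ENNReal.toReal_le_of_le_ofReal (by positivity) h1
  linarith

end RenormedFBL

end Renorming

/-! ### The free complex Banach lattice -/

/-- The free complex Banach lattice `FBL_ℂ[E] = FBL[E_ℝ] ⊕ i FBL[E_ℝ]`. -/
abbrev FBLC (E : Type*) [NormedAddCommGroup E] [NormedSpace ℂ E] : Type _ :=
  Complexification (RenormedFBL E)

/-- The canonical map `δ_{E_ℝ} : E → FBL[E_ℝ]`. -/
noncomputable def deltaReal {E : Type*} [NormedAddCommGroup E] [NormedSpace ℂ E] (x : E) :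
    RenormedFBL E := ⟨evalFun x, evalFun_mem_FBL x⟩

/-- The canonical map `δ_E(z) = δ_{E_ℝ}(z) - i δ_{E_ℝ}(i z)`. -/
noncomputable def deltaC {E : Type*} [NormedAddCommGroup E] [NormedSpace ℂ E] (z : E) : FBLC E :=
  ⟨deltaReal z, -deltaReal (Complex.I • z)⟩

/-- `(L ⊕ iL, δ)`, with `L` a real Banach lattice, is the free complex Banach lattice generated by
the complex Banach space `E`. The uniqueness is among all lattice homomorphisms, bounded or not. -/
structure IsFreeComplexBanachLattice (E : Type u) [NormedAddCommGroup E]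
    [NormedSpace ℂ E] (L : Type v) [NormedAddCommGroup L] [NormedSpace ℝ L] [Lattice L]
    [IsOrderedAddMonoid L] [IsOrderedModule ℝ L] [HasSolidNorm L] [CompleteSpace L]
    (δ : E → Complexification L) : Prop where
  isLinearMap : IsLinearMap ℂ δ
  isometry : Isometry δ
  existsUnique_extension : ∀ (X : Type w) [NormedAddCommGroup X] [NormedSpace ℝ X] [Lattice X]
    [IsOrderedAddMonoid X] [IsOrderedModule ℝ X] [HasSolidNorm X] [CompleteSpace X]
    (T : E →L[ℂ] Complexification X),
    ∃ T' : Complexification L →L[ℂ] Complexification X,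
      Complexification.IsLatticeHom (T' : Complexification L →ₗ[ℂ] Complexification X) ∧
      (∀ z, T' (δ z) = T z) ∧ ‖T'‖ = ‖T‖ ∧
      ∀ R : Complexification L →ₗ[ℂ] Complexification X,
        Complexification.IsLatticeHom R → (∀ z, R (δ z) = T z) → ∀ f, R f = T' f

/-!
Why the extension of `T` is bounded: let `f` be a lattice-linear expression in evaluations `δ_x`
and `u` the same expression in the `Re (T x)`. If a positive functional `y` on `X` were a lattice
homomorphism, `f (y ∘ Re T)` would be `y u`. In general it is not, but for `a, b ∈ X` it splits as
`y = y₁ + y₂` with `y₁ (a ⊔ b) = y₁ a` and `y₂ (a ⊔ b) = y₂ b`, so after finitely many splittings,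
one for each `⊔` in the expression, each piece `y_j` satisfies `f (y_j ∘ Re T) = y_j u`. Apply this
to `|f|` and a positive `y` of norm at most `1` with `y |u| = ‖u‖`. The complex functionals `z_j`
with real parts `y_j ∘ Re T` satisfy `|z_j x| ≤ y_j |T x|`, hence `∑ j, |z_j x| ≤ ‖T‖ ‖x‖`, and
the definition of the norm of `FBL_ℂ[E]` yields `‖u‖ ≤ ‖T‖ ‖f‖`.
Uniqueness holds without boundedness, since positive operators between Banach lattices are
automatically continuous.
-/

section PositiveFunctionals

theorem exists_linearMap_le_sublinear_eq {V : Type*} [AddCommGroup V] [Module ℝ V] (p : V → ℝ)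
    (p_smul : ∀ c : ℝ, 0 < c → ∀ x, p (c • x) = c * p x)
    (p_add : ∀ x y, p (x + y) ≤ p x + p y) (v : V) :
    ∃ f : V →ₗ[ℝ] ℝ, (∀ x, f x ≤ p x) ∧ f v = p v := by
  have p_zero : p 0 = 0 := by
    have h := p_smul 2 two_pos 0
    rw [smul_zero] at h
    linarith
  have mul_le_p_smul (t : ℝ) : t * p v ≤ p (t • v) := by
    rcases lt_trichotomy t 0 with ht | rfl | ht
    · have h := p_add (t • v) (-t • v)
      rw [← add_smul, add_neg_cancel, zero_smul, p_zero, p_smul _ (neg_pos.2 ht)] at h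
      linarith
    · simp [p_zero]
    · exact (p_smul t ht v).ge
  have smul_p_eq_zero (t : ℝ) (ht : t • v = 0) : t • p v = 0 := by
    rcases smul_eq_zero.1 ht with rfl | rfl
    · exact zero_smul ..
    · rw [p_zero, smul_zero]
  obtain ⟨f, f_eq, f_le⟩ := exists_extension_of_le_sublinear
    (LinearPMap.mkSpanSingleton' v (p v) smul_p_eq_zero) p p_smul p_add (by
      rintro ⟨x, hx⟩
      obtain ⟨t, rfl⟩ := Submodule.mem_span_singleton.1 hx
      rw [LinearPMap.mkSpanSingleton'_apply]
      exact mul_le_p_smul t)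
  exact ⟨f, f_le, (f_eq ⟨v, Submodule.mem_span_singleton_self v⟩).trans
    (LinearPMap.mkSpanSingleton'_apply_self ..)⟩

theorem posPart_smul_of_pos {X : Type*} [AddCommGroup X] [Module ℝ X] [Lattice X]
    [IsOrderedModule ℝ X] {c : ℝ} (hc : 0 < c) (x : X) : (c • x)⁺ = c • x⁺ := by
  simpa only [posPart_def, OrderIso.smulRight_apply, smul_zero] using
    ((OrderIso.smulRight hc).map_sup x 0).symm

theorem posPart_add_le {X : Type*} [AddCommGroup X] [Lattice X] [IsOrderedAddMonoid X] (x y : X) :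
    (x + y)⁺ ≤ x⁺ + y⁺ :=
  sup_le (add_le_add (le_posPart x) (le_posPart y))
    (add_nonneg (posPart_nonneg x) (posPart_nonneg y))

theorem norm_posPart_le {X : Type*} [NormedAddCommGroup X] [Lattice X] [IsOrderedAddMonoid X]
    [HasSolidNorm X] (x : X) : ‖x⁺‖ ≤ ‖x‖ := by
  simpa using lipschitzWith_posPart.norm_le_mul posPart_zero x

/-- The cone `X*₊` of positive functionals on an ordered topological vector space. Positivity is
encoded as monotonicity. -/
def positiveDual (X : Type*) [AddCommGroup X] [Module ℝ X] [TopologicalSpace X] [Preorder X] :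
    AddSubmonoid (StrongDual ℝ X) where
  carrier := {y | Monotone y}
  zero_mem' := monotone_const
  add_mem' hy hz := hy.add hz

variable {X : Type*} [NormedAddCommGroup X] [NormedSpace ℝ X] [Lattice X]
  [IsOrderedAddMonoid X] [IsOrderedModule ℝ X] [HasSolidNorm X]

theorem exists_mem_positiveDual_le_posPart {N : X → ℝ} {C : ℝ}
    (N_smul : ∀ c : ℝ, 0 < c → ∀ x, N (c • x) = c * N x)
    (N_add : ∀ x y, N (x + y) ≤ N x + N y) (N_mono : MonotoneOn N (Set.Ici 0))
    (hC : 0 ≤ C) (N_le : ∀ x, N x ≤ C * ‖x‖) (v : X) :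
    ∃ y ∈ positiveDual X, (∀ x, y x ≤ N x⁺) ∧ y v = N v⁺ := by
  obtain ⟨f, f_le, f_eq⟩ := exists_linearMap_le_sublinear_eq (fun x => N x⁺)
    (fun c hc x => by simp only [posPart_smul_of_pos hc, N_smul c hc])
    (fun x y => (N_mono (posPart_nonneg _) (add_nonneg (posPart_nonneg x) (posPart_nonneg y))
      (posPart_add_le x y)).trans (N_add _ _)) v
  have f_le_norm (x : X) : f x ≤ C * ‖x‖ :=
    (f_le x).trans ((N_le _).trans (mul_le_mul_of_nonneg_left (norm_posPart_le x) hC))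
  have abs_f_le (x : X) : ‖f x‖ ≤ C * ‖x‖ := abs_le'.2
    ⟨f_le_norm x, by simpa only [map_neg, norm_neg] using f_le_norm (-x)⟩
  have N_zero : N 0 = 0 := by
    have h := N_smul 2 two_pos 0
    rw [smul_zero] at h
    linarith
  refine ⟨f.mkContinuous C abs_f_le, fun a b hab => ?_, f_le, f_eq⟩
  have h := f_le (a - b)
  rw [posPart_of_nonpos (sub_nonpos.2 hab), N_zero, map_sub] at h
  exact sub_nonpos.1 h

theorem exists_mem_positiveDual_eq_norm {v : X} (hv : 0 ≤ v) :
    ∃ y ∈ positiveDual X, (∀ x, y x ≤ ‖x‖) ∧ y v = ‖v‖ := by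
  obtain ⟨y, hy, y_le, y_eq⟩ := exists_mem_positiveDual_le_posPart (C := 1)
    (fun c hc x => by rw [norm_smul, Real.norm_of_nonneg hc.le]) norm_add_le
    (fun a ha b _ hab => Complexification.norm_le_norm_of_nonneg ha hab) zero_le_one
    (fun x => (one_mul ‖x‖).ge) v
  exact ⟨y, hy, fun x => (y_le x).trans (norm_posPart_le x), by rw [y_eq, posPart_of_nonneg hv]⟩

/- The first summand is obtained by maximizing `f (a - b)` over `0 ≤ f ≤ y`: the maximum is
`y (a - b)⁺`. -/
theorem exists_add_eq_of_mem_positiveDual {y : StrongDual ℝ X} (hy : y ∈ positiveDual X)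
    (a b : X) : ∃ y₁ ∈ positiveDual X, ∃ y₂ ∈ positiveDual X,
      y₁ + y₂ = y ∧ y₁ (a ⊔ b) = y₁ a ∧ y₂ (a ⊔ b) = y₂ b := by
  obtain ⟨f, hf, f_le, f_eq⟩ := exists_mem_positiveDual_le_posPart (N := y)
    (fun c _ x => by rw [map_smul, smul_eq_mul]) (fun x z => (map_add y x z).le)
    (hy.monotoneOn _) (norm_nonneg y) (fun x => (le_abs_self _).trans (y.le_opNorm x)) (a - b)
  have f_le_of_nonneg {x : X} (hx : 0 ≤ x) : f x ≤ y x := by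
    simpa only [posPart_of_nonneg hx] using f_le x
  have f_posPart : f (a - b)⁺ = y (a - b)⁺ :=
    (f_le_of_nonneg (posPart_nonneg _)).antisymm (f_eq.ge.trans (hf (le_posPart _)))
  have sup_eq : a ⊔ b = b + (a - b)⁺ := by
    rw [posPart_def, add_sup, add_sub_cancel, add_zero]
  refine ⟨f, hf, y - f, fun u v huv => ?_, add_sub_cancel f y, ?_, ?_⟩
  · have h := f_le_of_nonneg (sub_nonneg.2 huv)
    rw [map_sub, map_sub] at h
    rw [sub_apply, sub_apply]
    linarith
  · rw [sup_eq, map_add, f_posPart, ← f_eq, map_sub, add_sub_cancel]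
  · rw [sup_eq, map_add, sub_apply (x := (a - b)⁺), f_posPart, sub_self, add_zero]

end PositiveFunctionals

section AutomaticContinuity

variable {X Y : Type*} [NormedAddCommGroup X] [NormedSpace ℝ X] [Lattice X]
  [NormedAddCommGroup Y] [NormedSpace ℝ Y] [Lattice Y] [HasSolidNorm Y]

theorem norm_map_le_norm_map_abs {S : X →ₗ[ℝ] Y} (hS : Monotone S) (x : X) :
    ‖S x‖ ≤ ‖S |x|‖ := by
  have abs_map_le : |S x| ≤ S |x| := abs_le'.2 ⟨hS (le_abs_self x), by
    simpa only [map_neg] using hS (neg_le_abs x)⟩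
  exact norm_le_norm_of_abs_le_abs (abs_map_le.trans (le_abs_self _))

variable [IsOrderedAddMonoid X] [IsOrderedModule ℝ X] [HasSolidNorm X]

theorem exists_nonneg_norm_le_of_lt_norm_map {S : X →ₗ[ℝ] Y} (hS : Monotone S)
    {K r : ℝ} (hr : 0 < r) {x : X} (hx : K * ‖x‖ < ‖S x‖) :
    ∃ w : X, 0 ≤ w ∧ ‖w‖ = r ∧ K * r ≤ ‖S w‖ := by
  have x_ne_zero : x ≠ 0 := by
    rintro rfl
    simp at hx
  have norm_pos : 0 < ‖x‖ := norm_pos_iff.2 x_ne_zero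
  refine ⟨(r / ‖x‖) • |x|, smul_nonneg (by positivity) (abs_nonneg x), ?_, ?_⟩
  · rw [norm_smul, norm_abs_eq_norm, Real.norm_of_nonneg (by positivity),
      div_mul_cancel₀ r norm_pos.ne']
  · rw [map_smul, norm_smul, Real.norm_of_nonneg (by positivity)]
    calc K * r = r / ‖x‖ * (K * ‖x‖) := by field_simp
      _ ≤ r / ‖x‖ * ‖S |x|‖ := by
        gcongr
        exact hx.le.trans (norm_map_le_norm_map_abs hS x)

theorem continuous_linearMap_of_monotone [CompleteSpace X] [IsOrderedAddMonoid Y]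
    {S : X →ₗ[ℝ] Y} (hS : Monotone S) : Continuous S := by
  suffices h : ∃ C, ∀ x, ‖S x‖ ≤ C * ‖x‖ from (S.mkContinuousOfExistsBound h).continuous
  by_contra! not_bounded
  choose x x_nonneg norm_x le_norm_map using fun n : ℕ =>
    exists_nonneg_norm_le_of_lt_norm_map hS (r := (1 / 2) ^ n) (by positivity)
      (not_bounded (n * 2 ^ n)).choose_spec
  have summable_x : Summable x :=
    Summable.of_norm_bounded summable_geometric_two fun n => (norm_x n).le
  obtain ⟨n, hn⟩ := exists_nat_gt ‖S (∑' k, x k)‖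
  have map_nonneg : 0 ≤ S (x n) := by simpa only [map_zero] using hS (x_nonneg n)
  have norm_map_le : ‖S (x n)‖ ≤ ‖S (∑' k, x k)‖ :=
    Complexification.norm_le_norm_of_nonneg map_nonneg
      (hS (summable_x.le_tsum n fun k _ => x_nonneg k))
  have le_norm : (n : ℝ) ≤ ‖S (x n)‖ := by
    simpa [mul_assoc, ← mul_pow] using le_norm_map n
  linarith

end AutomaticContinuity

namespace Complexification

theorem modulus_real (a b : ℝ) :
    (⟨a, b⟩ : Complexification ℝ).modulus = ‖(a : ℂ) + Complex.I * b‖ := by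
  set w : ℂ := a + Complex.I * b with hw
  have rotation_eq (θ : ℝ) :
      Real.cos θ • a + Real.sin θ • b = ‖w‖ * Real.cos (θ - w.arg) := by
    have re_eq : ‖w‖ * Real.cos w.arg = a := by simp [Complex.norm_mul_cos_arg, hw]
    have im_eq : ‖w‖ * Real.sin w.arg = b := by simp [Complex.norm_mul_sin_arg, hw]
    rw [Real.cos_sub, smul_eq_mul, smul_eq_mul, ← re_eq, ← im_eq]
    ring
  apply le_antisymm
  · refine modulus_le fun θ => ?_
    rw [rotation_eq]
    exact mul_le_of_le_one_right (norm_nonneg w) (Real.cos_le_one _)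
  · have h := rotation_le_modulus (⟨a, b⟩ : Complexification ℝ) w.arg
    rwa [rotation_eq, sub_self, Real.cos_zero, mul_one] at h

variable {X : Type*} [NormedAddCommGroup X] [NormedSpace ℝ X] [Lattice X]
  [IsOrderedAddMonoid X] [IsOrderedModule ℝ X] [HasSolidNorm X] [CompleteSpace X]

theorem norm_re_le (z : Complexification X) : ‖z.re‖ ≤ ‖z‖ :=
  norm_le_norm_of_abs_le_abs (z.abs_re_le_modulus.trans (le_abs_self _))

theorem exists_modulus_le_sup'_add (z : Complexification X) {ε : ℝ} (hε : 0 < ε) :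
    ∃ (t : Finset ℝ) (ht : t.Nonempty),
      z.modulus ≤ t.sup' ht (fun θ => Real.cos θ • z.re + Real.sin θ • z.im)
        + ε • (|z.re| + |z.im|) := by
  obtain ⟨t, -, t_finite, covers⟩ :=
    (isCompact_Icc (a := (0 : ℝ)) (b := 2 * Real.pi)).finite_cover_balls hε
  have exists_near {θ : ℝ} (hθ : θ ∈ Set.Icc 0 (2 * Real.pi)) :
      ∃ τ ∈ t_finite.toFinset, |θ - τ| ≤ ε := by
    obtain ⟨τ, hτ, near⟩ := Set.mem_iUnion₂.1 (covers hθ)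
    exact ⟨τ, t_finite.mem_toFinset.2 hτ, (Metric.mem_ball.1 near).le⟩
  obtain ⟨τ, hτ, -⟩ := exists_near (Set.left_mem_Icc.2 Real.two_pi_pos.le)
  refine ⟨t_finite.toFinset, ⟨τ, hτ⟩, z.isLUB_modulus.2 ?_⟩
  rintro _ ⟨θ, hθ, rfl⟩
  obtain ⟨τ, hτ, near⟩ := exists_near hθ
  exact (rotation_le z.re z.im θ τ).trans (add_le_add
    (Finset.le_sup' (fun τ : ℝ => Real.cos τ • z.re + Real.sin τ • z.im) hτ)
    (smul_le_smul_of_nonneg_right near (add_nonneg (abs_nonneg _) (abs_nonneg _))))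

variable {Y : Type*} [NormedAddCommGroup Y] [NormedSpace ℝ Y] [Lattice Y]
  [IsOrderedAddMonoid Y] [IsOrderedModule ℝ Y] [HasSolidNorm Y] [CompleteSpace Y]

theorem modulus_map_le {S : X →ₗ[ℝ] Y} (hS : Monotone S) (z : Complexification X) :
    modulus ⟨S z.re, S z.im⟩ ≤ S z.modulus :=
  modulus_le fun θ => by
    simpa only [map_add, map_smul] using hS (z.rotation_le_modulus θ)

theorem modulus_map {S : X →ₗ[ℝ] Y} (hS : ∀ x y, S (x ⊔ y) = S x ⊔ S y)
    (z : Complexification X) : modulus ⟨S z.re, S z.im⟩ = S z.modulus := by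
  have S_mono : Monotone S := Monotone.of_map_sup hS
  refine (modulus_map_le S_mono z).antisymm ?_
  set m : Y := modulus ⟨S z.re, S z.im⟩
  have map_modulus_le {ε : ℝ} (hε : 0 < ε) : S z.modulus ≤ m + ε • S (|z.re| + |z.im|) := by
    obtain ⟨t, ht, h⟩ := z.exists_modulus_le_sup'_add hε
    refine (S_mono h).trans ?_
    rw [map_add, map_smul, Finset.apply_sup'_eq_sup'_comp ht S hS]
    gcongr
    refine Finset.sup'_le _ _ fun θ _ => ?_
    simpa only [Function.comp_apply, map_add, map_smul] using
      rotation_le_modulus ⟨S z.re, S z.im⟩ θ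
  have tendsto_m : Filter.Tendsto (fun ε : ℝ => m + ε • S (|z.re| + |z.im|))
      (nhdsWithin 0 (Set.Ioi 0)) (nhds m) :=
    tendsto_nhdsWithin_of_tendsto_nhds (Continuous.tendsto' (by fun_prop) _ _ (by simp))
  exact ge_of_tendsto tendsto_m (eventually_mem_nhdsWithin.mono fun _ => map_modulus_le)

end Complexification

section Representation

theorem closure_le_closure_inter_of_hereditary {M : Type*} [AddCommMonoid M] {C D : Set M}
    (subset_closure : C ⊆ AddSubmonoid.closure D)
    (hereditary : ∀ a ∈ AddSubmonoid.closure D, ∀ b ∈ AddSubmonoid.closure D, a + b ∈ C → a ∈ C) :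
    AddSubmonoid.closure C ≤ AddSubmonoid.closure (C ∩ D) := by
  have mem_of_mem {x : M} (hx : x ∈ AddSubmonoid.closure D) :
      x ∈ C → x ∈ AddSubmonoid.closure (C ∩ D) := by
    induction hx using AddSubmonoid.closure_induction with
    | mem x hx => exact fun hxC => AddSubmonoid.subset_closure ⟨hxC, hx⟩
    | zero => exact fun _ => zero_mem _
    | add a b ha hb iha ihb =>
      intro hab
      have hba : b + a ∈ C := add_comm a b ▸ hab
      exact add_mem (iha (hereditary a ha b hb hab)) (ihb (hereditary b hb a ha hba))
  exact AddSubmonoid.closure_le.2 fun x hx => mem_of_mem (subset_closure hx) hx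

variable {F : Type*} [NormedAddCommGroup F] [NormedSpace ℝ F]

section Preorder

variable {X : Type*} [AddCommGroup X] [Module ℝ X] [TopologicalSpace X] [Preorder X]

/-- For a pair `p = (f, u)`, the positive functionals `y` such that `f (y' ∘ R) = y' u` whenever
`0 ≤ y' ≤ y`. Quantifying over all such `y'` makes this set hereditary, so that two representations
have a common refinement. -/
def representingFunctionals (R : F →L[ℝ] X) (p : (StrongDual ℝ F → ℝ) × X) :
    Set (StrongDual ℝ X) :=
  {y | y ∈ positiveDual X ∧
    ∀ y' ∈ positiveDual X, y - y' ∈ positiveDual X → p.1 (y'.comp R) = y' p.2}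

variable {R : F →L[ℝ] X} {p q : (StrongDual ℝ F → ℝ) × X} {y : StrongDual ℝ X}

theorem apply_comp_of_mem_representingFunctionals (hy : y ∈ representingFunctionals R p) :
    p.1 (y.comp R) = y p.2 :=
  hy.2 y hy.1 (sub_self y ▸ zero_mem _)

theorem mem_representingFunctionals_of_add_mem {y₁ y₂ : StrongDual ℝ X}
    (h₁ : y₁ ∈ positiveDual X) (h₂ : y₂ ∈ positiveDual X)
    (h : y₁ + y₂ ∈ representingFunctionals R p) : y₁ ∈ representingFunctionals R p :=
  ⟨h₁, fun y' hy' hsub => h.2 y' hy' (by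
    rw [add_sub_right_comm]
    exact add_mem hsub h₂)⟩

theorem closure_representingFunctionals_le (R : F →L[ℝ] X) (p : (StrongDual ℝ F → ℝ) × X) :
    AddSubmonoid.closure (representingFunctionals R p) ≤ positiveDual X :=
  AddSubmonoid.closure_le.2 fun _ hy => hy.1

theorem positiveDual_le_closure_inter
    (hp : positiveDual X ≤ AddSubmonoid.closure (representingFunctionals R p))
    (hq : positiveDual X ≤ AddSubmonoid.closure (representingFunctionals R q)) :
    positiveDual X ≤
      AddSubmonoid.closure (representingFunctionals R p ∩ representingFunctionals R q) :=
  hp.trans (closure_le_closure_inter_of_hereditary (fun _ hy => hq hy.1) fun _ ha _ hb =>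
    mem_representingFunctionals_of_add_mem (closure_representingFunctionals_le R q ha)
      (closure_representingFunctionals_le R q hb))

/-- The pairs `(f, u)` such that every positive functional is a finite sum of functionals
representing `(f, u)`. It relates the lattice-linear expressions in the evaluations `δ_x` to the
same expressions in the `R x`. -/
def representationSubmodule (R : F →L[ℝ] X) : Submodule ℝ ((StrongDual ℝ F → ℝ) × X) where
  carrier := {p | positiveDual X ≤ AddSubmonoid.closure (representingFunctionals R p)}
  zero_mem' _ hy := AddSubmonoid.subset_closure ⟨hy, fun y' _ _ => (map_zero y').symm⟩
  add_mem' {p q} hp hq := by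
    refine (positiveDual_le_closure_inter hp hq).trans (AddSubmonoid.closure_mono ?_)
    rintro y ⟨hyp, hyq⟩
    refine ⟨hyp.1, fun y' hy' hsub => ?_⟩
    rw [Prod.fst_add, Pi.add_apply, hyp.2 y' hy' hsub, hyq.2 y' hy' hsub, Prod.snd_add, map_add]
  smul_mem' c p hp := by
    refine hp.trans (AddSubmonoid.closure_mono ?_)
    intro y hy
    refine ⟨hy.1, fun y' hy' hsub => ?_⟩
    rw [Prod.smul_fst, Pi.smul_apply, hy.2 y' hy' hsub, Prod.smul_snd, map_smul]

theorem evalFun_mem_representationSubmodule (R : F →L[ℝ] X) (x : F) :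
    (evalFun x, R x) ∈ representationSubmodule R := fun _ hy =>
  AddSubmonoid.subset_closure ⟨hy, fun _ _ _ => rfl⟩

end Preorder

theorem mem_representingFunctionals_sup {X : Type*} [AddCommGroup X] [Module ℝ X]
    [TopologicalSpace X] [Lattice X] {R : F →L[ℝ] X} {p q : (StrongDual ℝ F → ℝ) × X}
    {y : StrongDual ℝ X} (hp : y ∈ representingFunctionals R p)
    (hq : y ∈ representingFunctionals R q) (apply_sup : y (p.2 ⊔ q.2) = y p.2) :
    y ∈ representingFunctionals R (p ⊔ q) := by
  refine ⟨hp.1, fun y' hy' hsub => ?_⟩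
  have apply_sup' : y' (p.2 ⊔ q.2) = y' p.2 := by
    refine le_antisymm ?_ (hy' le_sup_left)
    have h : (y - y') p.2 ≤ (y - y') (p.2 ⊔ q.2) := hsub le_sup_left
    rw [sub_apply, sub_apply, apply_sup] at h
    exact (sub_le_sub_iff_left _).1 h
  have apply_le : y' q.2 ≤ y' p.2 := apply_sup' ▸ hy' le_sup_right
  rw [Prod.fst_sup, Pi.sup_apply, hp.2 y' hy' hsub, hq.2 y' hy' hsub, Prod.snd_sup, apply_sup',
    sup_of_le_left apply_le]

variable {X : Type*} [NormedAddCommGroup X] [NormedSpace ℝ X] [Lattice X]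
  [IsOrderedAddMonoid X] [IsOrderedModule ℝ X] [HasSolidNorm X]
  {R : F →L[ℝ] X} {p q : (StrongDual ℝ F → ℝ) × X}

theorem sup_mem_representationSubmodule (hp : p ∈ representationSubmodule R)
    (hq : q ∈ representationSubmodule R) : p ⊔ q ∈ representationSubmodule R := by
  refine (positiveDual_le_closure_inter hp hq).trans (AddSubmonoid.closure_le.2 ?_)
  rintro y ⟨hyp, hyq⟩
  obtain ⟨y₁, h₁, y₂, h₂, rfl, apply_sup₁, apply_sup₂⟩ :=
    exists_add_eq_of_mem_positiveDual hyp.1 p.2 q.2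
  have mem₁ : y₁ ∈ representingFunctionals R (p ⊔ q) := mem_representingFunctionals_sup
    (mem_representingFunctionals_of_add_mem h₁ h₂ hyp)
    (mem_representingFunctionals_of_add_mem h₁ h₂ hyq) apply_sup₁
  rw [add_comm] at hyp hyq
  have mem₂ : y₂ ∈ representingFunctionals R (p ⊔ q) := sup_comm q p ▸
    mem_representingFunctionals_sup (mem_representingFunctionals_of_add_mem h₂ h₁ hyq)
      (mem_representingFunctionals_of_add_mem h₂ h₁ hyp) (sup_comm p.2 q.2 ▸ apply_sup₂)
  exact add_mem (AddSubmonoid.subset_closure mem₁) (AddSubmonoid.subset_closure mem₂)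

theorem exists_sum_eq_norm_of_mem_representationSubmodule (hp : p ∈ representationSubmodule R) :
    ∃ (m : ℕ) (y : Fin m → StrongDual ℝ X), (∀ j, y j ∈ positiveDual X) ∧
      (∀ x, ∑ j, y j x ≤ ‖x‖) ∧ ∑ j, |p.1 ((y j).comp R)| = ‖p.2‖ := by
  obtain ⟨y, hy, y_le, y_eq⟩ := exists_mem_positiveDual_eq_norm (abs_nonneg p.2)
  have abs_mem : |p| ∈ representationSubmodule R := sup_mem_representationSubmodule hp (neg_mem hp)
  obtain ⟨l, l_mem, sum_l⟩ := AddSubmonoid.exists_list_of_mem_closure (abs_mem hy)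
  have sum_apply_eq (v : X) : ∑ j : Fin l.length, l[j] v = y v := by
    rw [← sum_l, ← Fin.sum_univ_getElem, sum_apply]
    rfl
  have l_getElem_mem (j : Fin l.length) : l[j] ∈ representingFunctionals R |p| :=
    l_mem _ (List.getElem_mem _)
  refine ⟨l.length, fun j => l[j], fun j => (l_getElem_mem j).1,
    fun x => (sum_apply_eq x).trans_le (y_le x), ?_⟩
  rw [← norm_abs_eq_norm, ← y_eq, ← sum_apply_eq]
  exact Finset.sum_congr rfl fun j _ =>
    apply_comp_of_mem_representingFunctionals (l_getElem_mem j)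

end Representation

section BoundedGraph

variable {𝕜 A B : Type*} [NontriviallyNormedField 𝕜] [NormedAddCommGroup A] [NormedSpace 𝕜 A]
  [NormedAddCommGroup B] [NormedSpace 𝕜 B] {G : Submodule 𝕜 (A × B)} {C : NNReal}

theorem isClosed_map_fst_of_norm_snd_le [CompleteSpace A] [CompleteSpace B]
    (hG : IsClosed (G : Set (A × B))) (bound : ∀ p ∈ G, ‖p.2‖ ≤ C * ‖p.1‖) :
    IsClosed (G.map (LinearMap.fst 𝕜 A B) : Set A) := by
  have : CompleteSpace G := hG.completeSpace_coe
  let π : G →L[𝕜] A := (ContinuousLinearMap.fst 𝕜 A B).comp G.subtypeL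
  have antilipschitz : AntilipschitzWith (max 1 C) π := by
    refine AddMonoidHomClass.antilipschitz_of_bound π fun p => ?_
    rw [NNReal.coe_max, NNReal.coe_one]
    exact max_le (le_mul_of_one_le_left (norm_nonneg _) (le_max_left ..))
      ((bound p p.2).trans (by gcongr; exacts [le_max_right .., le_rfl]))
  have range_eq : Set.range π = G.map (LinearMap.fst 𝕜 A B) := by
    ext a
    simp [π]
  exact range_eq ▸ antilipschitz.isClosed_range π.uniformContinuous

theorem exists_eq_graph_of_norm_snd_le (bound : ∀ p ∈ G, ‖p.2‖ ≤ C * ‖p.1‖)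
    (map_fst : G.map (LinearMap.fst 𝕜 A B) = ⊤) : ∃ S : A →ₗ[𝕜] B, G = S.graph := by
  refine Submodule.exists_eq_graph ⟨fun p q hpq => ?_, fun a => ?_⟩
  · have fst_eq : p.1.1 = q.1.1 := hpq
    have norm_sub_le : ‖p.1.2 - q.1.2‖ ≤ 0 := by
      simpa [fst_eq] using bound (p.1 - q.1) (sub_mem p.2 q.2)
    exact Subtype.ext (Prod.ext fst_eq (sub_eq_zero.1 (norm_le_zero_iff.1 norm_sub_le)))
  · obtain ⟨p, hp, rfl⟩ : a ∈ G.map (LinearMap.fst 𝕜 A B) := map_fst ▸ Submodule.mem_top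
    exact ⟨⟨p, hp⟩, rfl⟩

end BoundedGraph

section ComplexTuples

theorem IsAdmissible.sum_norm_apply_le {𝕜 F : Type*} [RCLike 𝕜] [NormedAddCommGroup F]
    [NormedSpace 𝕜 F] {m : ℕ} {φ : Fin m → StrongDual 𝕜 F} (hφ : IsAdmissible 𝕜 F m φ) (x : F) :
    ∑ j, ‖φ j x‖ ≤ ‖x‖ := by
  rcases eq_or_ne x 0 with rfl | hx
  · simp
  have norm_pos : 0 < ‖x‖ := norm_pos_iff.2 hx
  have h := hφ ((‖x‖ : 𝕜)⁻¹ • x) (norm_smul_inv_norm hx).le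
  simp only [map_smul, norm_smul, norm_inv, RCLike.norm_ofReal, abs_norm] at h
  rwa [← Finset.mul_sum, inv_mul_le_iff₀ norm_pos, mul_one] at h

variable {E : Type*} [NormedAddCommGroup E] [NormedSpace ℂ E]

theorem rePart_extendRCLike (φ : StrongDual ℝ E) :
    rePart (StrongDual.extendRCLike φ : StrongDual ℂ E) = φ := by
  ext x
  exact StrongDual.re_extendRCLike_apply (𝕜 := ℂ) φ x

theorem rePart_real_smul (c : ℝ) (z : StrongDual ℂ E) : rePart ((c : ℂ) • z) = c • rePart z := by
  ext x
  simp

theorem sum_norm_apply_rePart_le_of_pos {f : StrongDual ℝ E → ℝ} (hf : f ∈ FBL E) {m : ℕ}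
    {z : Fin m → StrongDual ℂ E} {c : ℝ} (hc : 0 < c) (hz : ∀ x, ∑ j, ‖z j x‖ ≤ c * ‖x‖) :
    ∑ j, |f (rePart (z j))| ≤ c * (cfblNorm f).toReal := by
  have norm_inv : ‖((c⁻¹ : ℝ) : ℂ)‖ = c⁻¹ := by
    rw [Complex.norm_real, Real.norm_of_nonneg (inv_nonneg.2 hc.le)]
  have admissible : IsAdmissible ℂ E m fun j => ((c⁻¹ : ℝ) : ℂ) • z j := by
    intro x hx
    simp only [smul_apply, norm_smul, norm_inv]
    rw [← Finset.mul_sum, inv_mul_le_iff₀ hc]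
    exact (hz x).trans (mul_le_mul_of_nonneg_left hx hc.le)
  have h : _ ≤ cfblNorm f := le_tupleSup admissible fun z => f (rePart z)
  rw [ENNReal.ofReal_le_iff_le_toReal (cfblNorm_ne_top hf)] at h
  simp only [rePart_real_smul, (isClosedSublattice_FBL.le_H1 hf).1 _ _ (inv_nonneg.2 hc.le),
    norm_mul, Real.norm_of_nonneg (inv_nonneg.2 hc.le), Real.norm_eq_abs] at h
  rwa [← Finset.mul_sum, inv_mul_le_iff₀ hc] at h

theorem sum_norm_apply_rePart_le {f : StrongDual ℝ E → ℝ} (hf : f ∈ FBL E) {m : ℕ}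
    {z : Fin m → StrongDual ℂ E} {c : ℝ} (hc : 0 ≤ c) (hz : ∀ x, ∑ j, ‖z j x‖ ≤ c * ‖x‖) :
    ∑ j, |f (rePart (z j))| ≤ c * (cfblNorm f).toReal := by
  have le_of_lt {d : ℝ} (hd : c < d) : ∑ j, |f (rePart (z j))| ≤ d * (cfblNorm f).toReal :=
    sum_norm_apply_rePart_le_of_pos hf (hc.trans_lt hd) fun x => (hz x).trans (by gcongr)
  exact ge_of_tendsto (tendsto_nhdsWithin_of_tendsto_nhds
    (Continuous.tendsto (by fun_prop : Continuous fun d => d * (cfblNorm f).toReal) c))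
    (eventually_mem_nhdsWithin.mono fun _ => le_of_lt : ∀ᶠ d in nhdsWithin c (Set.Ioi c), _)

variable {X : Type*} [NormedAddCommGroup X] [NormedSpace ℝ X] [Lattice X]
  [IsOrderedAddMonoid X] [IsOrderedModule ℝ X] [HasSolidNorm X] [CompleteSpace X]

/-- The real part `x ↦ Re (T x)` of an operator into a complex Banach lattice, as a real operator.
It determines `T`, since `Im (T x) = -Re (T (i x))`. -/
noncomputable def reOperator (T : E →L[ℂ] Complexification X) : E →L[ℝ] X :=
  LinearMap.mkContinuous
    { toFun := fun x => (T x).re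
      map_add' := fun x y => by rw [map_add, Complexification.add_re]
      map_smul' := fun c x => by
        rw [← Complex.coe_smul c x, map_smul, Complexification.smul_re]
        simp }
    ‖T‖ fun x => (T x).norm_re_le.trans (T.le_opNorm x)

@[simp] theorem reOperator_apply (T : E →L[ℂ] Complexification X) (x : E) :
    reOperator T x = (T x).re := rfl

theorem reOperator_I_smul (T : E →L[ℂ] Complexification X) (x : E) :
    reOperator T (Complex.I • x) = -(T x).im := by simp

theorem norm_extendRCLike_comp_reOperator_le {y : StrongDual ℝ X} (hy : y ∈ positiveDual X)
    (T : E →L[ℂ] Complexification X) (x : E) :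
    ‖(StrongDual.extendRCLike (y.comp (reOperator T)) : StrongDual ℂ E) x‖ ≤ y (T x).modulus := by
  have apply_eq : (StrongDual.extendRCLike (y.comp (reOperator T)) : StrongDual ℂ E) x
      = (y (T x).re : ℂ) + Complex.I * (y (T x).im : ℂ) := by
    simp [StrongDual.extendRCLike_apply]
  rw [apply_eq, ← Complexification.modulus_real]
  exact Complexification.modulus_map_le (S := y.toLinearMap) hy (T x)

theorem norm_snd_le_of_mem_representationSubmodule (T : E →L[ℂ] Complexification X)
    {p : (StrongDual ℝ E → ℝ) × X} (hp : p ∈ representationSubmodule (reOperator T))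
    (mem_FBL : p.1 ∈ FBL E) : ‖p.2‖ ≤ ‖T‖ * (cfblNorm p.1).toReal := by
  obtain ⟨m, y, hy, sum_y_le, sum_eq⟩ := exists_sum_eq_norm_of_mem_representationSubmodule hp
  have sum_norm_le (x : E) :
      ∑ j, ‖(StrongDual.extendRCLike ((y j).comp (reOperator T)) : StrongDual ℂ E) x‖
        ≤ ‖T‖ * ‖x‖ :=
    calc _ ≤ ∑ j, y j (T x).modulus := Finset.sum_le_sum fun j _ =>
          norm_extendRCLike_comp_reOperator_le (hy j) T x
      _ ≤ ‖T x‖ := sum_y_le _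
      _ ≤ ‖T‖ * ‖x‖ := T.le_opNorm x
  rw [← sum_eq]
  simpa only [rePart_extendRCLike] using
    sum_norm_apply_rePart_le mem_FBL (norm_nonneg T) sum_norm_le

end ComplexTuples

section RealExtension

namespace RenormedFBL

variable {E : Type*} [NormedAddCommGroup E] [NormedSpace ℂ E]

/-- The inclusion of `FBL[E_ℝ]` into the real functions on the dual, as a linear map. -/
noncomputable def coeLinearMap : RenormedFBL E →ₗ[ℝ] (StrongDual ℝ E → ℝ) :=
  (FBL E).subtype

theorem mem_map_coeLinearMap_of_approx {K : Submodule ℝ (RenormedFBL E)}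
    (hK : IsClosed (K : Set (RenormedFBL E)))
    {g : StrongDual ℝ E → ℝ} (hg : g ∈ H1 E)
    (approx : ∀ ε : ℝ≥0∞, 0 < ε → ∃ h ∈ K.map coeLinearMap, fblNorm (g - h) < ε) :
    g ∈ K.map coeLinearMap := by
  have mem_FBL : g ∈ FBL E := isClosedSublattice_FBL.closed g hg fun ε hε => by
    obtain ⟨_, ⟨h, -, rfl⟩, hlt⟩ := approx ε hε
    exact ⟨_, h.2, hlt⟩
  let g' : RenormedFBL E := ⟨g, mem_FBL⟩
  refine ⟨g', hK.closure_subset (Metric.mem_closure_iff.2 fun ε hε => ?_), rfl⟩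
  obtain ⟨_, ⟨h, hh, rfl⟩, hlt⟩ := approx (ENNReal.ofReal ε) (ENNReal.ofReal_pos.2 hε)
  refine ⟨h, hh, ?_⟩
  rw [dist_eq_norm, ← ENNReal.ofReal_lt_ofReal_iff hε, ofReal_norm]
  exact (cfblNorm_le _).trans_lt hlt

theorem eq_top_of_isClosed {K : Submodule ℝ (RenormedFBL E)}
    (hK : IsClosed (K : Set (RenormedFBL E))) (sup_mem : ∀ f ∈ K, ∀ g ∈ K, f ⊔ g ∈ K)
    (deltaReal_mem : ∀ x : E, deltaReal x ∈ K) : K = ⊤ := by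
  have isClosedSublattice : IsClosedSublattice (K.map coeLinearMap) :=
    { le_H1 := by
        rintro _ ⟨f, -, rfl⟩
        exact isClosedSublattice_FBL.le_H1 f.2
      sup_mem := by
        rintro _ ⟨f, hf, rfl⟩ _ ⟨g, hg, rfl⟩
        exact ⟨f ⊔ g, sup_mem f hf g hg, rfl⟩
      closed := fun _ => mem_map_coeLinearMap_of_approx hK }
  refine eq_top_iff.2 fun f _ => ?_
  obtain ⟨g, hg, coe_eq⟩ := Submodule.mem_sInf.1 f.2 _
    ⟨isClosedSublattice, fun x => ⟨deltaReal x, deltaReal_mem x, rfl⟩⟩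
  have g_eq : g = f := Subtype.ext coe_eq
  exact g_eq ▸ hg

theorem eq_of_map_sup {X : Type*} [NormedAddCommGroup X] [NormedSpace ℝ X]
    [Lattice X] [IsOrderedAddMonoid X] [HasSolidNorm X] {S S' : RenormedFBL E →ₗ[ℝ] X}
    (hS : ∀ f g, S (f ⊔ g) = S f ⊔ S g) (hS' : ∀ f g, S' (f ⊔ g) = S' f ⊔ S' g)
    (h : ∀ x : E, S (deltaReal x) = S' (deltaReal x)) : S = S' := by
  refine LinearMap.eqLocus_eq_top.1 (eq_top_of_isClosed (isClosed_eq
    (continuous_linearMap_of_monotone (Monotone.of_map_sup hS))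
    (continuous_linearMap_of_monotone (Monotone.of_map_sup hS'))) (fun f hf g hg => ?_) h)
  rw [LinearMap.mem_eqLocus] at hf hg ⊢
  rw [hS, hS', hf, hg]

end RenormedFBL

variable {E : Type*} [NormedAddCommGroup E] [NormedSpace ℂ E]
  {X : Type*} [NormedAddCommGroup X] [NormedSpace ℝ X] [Lattice X]
  [IsOrderedAddMonoid X] [IsOrderedModule ℝ X] [HasSolidNorm X] [CompleteSpace X]
  (T : E →L[ℂ] Complexification X)

/-- The graph of the lattice homomorphism extending `Re T` to `FBL[E_ℝ]`, obtained as the closure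
of the pairs `(f, u)` of `representationSubmodule (reOperator T)` with `f ∈ FBL[E_ℝ]`. -/
noncomputable def extensionGraph : Submodule ℝ (RenormedFBL E × X) :=
  ((representationSubmodule (reOperator T)).comap
    (RenormedFBL.coeLinearMap.prodMap LinearMap.id)).topologicalClosure

theorem isClosed_extensionGraph : IsClosed (extensionGraph T : Set (RenormedFBL E × X)) :=
  Submodule.isClosed_topologicalClosure _

theorem norm_snd_le_of_mem_extensionGraph {p : RenormedFBL E × X} (hp : p ∈ extensionGraph T) :
    ‖p.2‖ ≤ ‖T‖₊ * ‖p.1‖ :=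
  closure_minimal (t := {p : RenormedFBL E × X | ‖p.2‖ ≤ ‖T‖₊ * ‖p.1‖})
    (fun p hp => norm_snd_le_of_mem_representationSubmodule (p := (p.1.1, p.2)) T hp p.1.2)
    (isClosed_le (by fun_prop) (by fun_prop)) hp

theorem sup_mem_extensionGraph {p q : RenormedFBL E × X} (hp : p ∈ extensionGraph T)
    (hq : q ∈ extensionGraph T) : p ⊔ q ∈ extensionGraph T :=
  map_mem_closure₂ (f := fun p q : RenormedFBL E × X => p ⊔ q)
    ((continuous_fst.fst.sup continuous_snd.fst).prodMk
      (continuous_fst.snd.sup continuous_snd.snd))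
    hp hq fun p hp q hq =>
      sup_mem_representationSubmodule (p := (p.1.1, p.2)) (q := (q.1.1, q.2)) hp hq

theorem deltaReal_mem_extensionGraph (x : E) : (deltaReal x, (T x).re) ∈ extensionGraph T :=
  subset_closure (evalFun_mem_representationSubmodule (reOperator T) x)

theorem map_fst_extensionGraph :
    (extensionGraph T).map (LinearMap.fst ℝ (RenormedFBL E) X) = ⊤ := by
  refine RenormedFBL.eq_top_of_isClosed (isClosed_map_fst_of_norm_snd_le (C := ‖T‖₊)
    (isClosed_extensionGraph T) fun p => norm_snd_le_of_mem_extensionGraph T) ?_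
    fun x => ⟨_, deltaReal_mem_extensionGraph T x, rfl⟩
  rintro _ ⟨p, hp, rfl⟩ _ ⟨q, hq, rfl⟩
  exact ⟨p ⊔ q, sup_mem_extensionGraph T hp hq, rfl⟩

theorem exists_map_sup_extension :
    ∃ S : RenormedFBL E →L[ℝ] X, (∀ f g, S (f ⊔ g) = S f ⊔ S g) ∧
      (∀ x, S (deltaReal x) = (T x).re) ∧ ‖S‖ ≤ ‖T‖ := by
  obtain ⟨S, graph_eq⟩ := exists_eq_graph_of_norm_snd_le
    (fun p => norm_snd_le_of_mem_extensionGraph T) (map_fst_extensionGraph T)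
  have mk_mem (f : RenormedFBL E) : (f, S f) ∈ extensionGraph T :=
    graph_eq ▸ (S.mem_graph_iff _).2 rfl
  have eq_of_mem {f : RenormedFBL E} {u : X} (h : (f, u) ∈ extensionGraph T) : S f = u := by
    rw [graph_eq, LinearMap.mem_graph_iff] at h
    exact h.symm
  exact ⟨S.mkContinuous ‖T‖ fun f => norm_snd_le_of_mem_extensionGraph T (mk_mem f),
    fun f g => eq_of_mem (sup_mem_extensionGraph T (mk_mem f) (mk_mem g)),
    fun x => eq_of_mem (deltaReal_mem_extensionGraph T x),
    S.mkContinuous_norm_le (norm_nonneg T) _⟩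

end RealExtension

section LatticeHomomorphisms

namespace Complexification

variable {X Y : Type*} [NormedAddCommGroup X] [NormedSpace ℝ X] [Lattice X]
  [IsOrderedAddMonoid X] [IsOrderedModule ℝ X] [HasSolidNorm X] [CompleteSpace X]
  [NormedAddCommGroup Y] [NormedSpace ℝ Y] [Lattice Y]
  [IsOrderedAddMonoid Y] [IsOrderedModule ℝ Y] [HasSolidNorm Y] [CompleteSpace Y]

/-- The complexification `x + iy ↦ S x + i S y` of a positive operator `S`. Positivity gives
`|S x + i S y| ≤ S |x + iy|`, so the norm does not increase. -/
noncomputable def complexify (S : X →L[ℝ] Y) (hS : Monotone S) :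
    Complexification X →L[ℂ] Complexification Y :=
  LinearMap.mkContinuous
    { toFun := fun z => ⟨S z.re, S z.im⟩
      map_add' := fun z w => by ext <;> simp
      map_smul' := fun c z => by ext <;> simp }
    ‖S‖ fun z => (norm_le_norm_of_nonneg (modulus_nonneg _)
      (modulus_map_le (S := S.toLinearMap) hS z)).trans (S.le_opNorm z.modulus)

theorem complexify_apply (S : X →L[ℝ] Y) (hS : Monotone S) (z : Complexification X) :
    complexify S hS z = ⟨S z.re, S z.im⟩ := rfl

theorem norm_complexify_le (S : X →L[ℝ] Y) (hS : Monotone S) : ‖complexify S hS‖ ≤ ‖S‖ :=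
  LinearMap.mkContinuous_norm_le _ (norm_nonneg S) _

theorem isLatticeHom_complexify {S : X →L[ℝ] Y} (hS : Monotone S)
    (map_sup : ∀ x y, S (x ⊔ y) = S x ⊔ S y) :
    IsLatticeHom (complexify S hS : Complexification X →ₗ[ℂ] Complexification Y) := by
  refine ⟨S, map_sup, fun x y => ?_, complexify_apply S hS⟩
  have inf_eq : x ⊓ y = -(-x ⊔ -y) := by rw [neg_sup, neg_neg, neg_neg]
  change S (x ⊓ y) = S x ⊓ S y
  rw [inf_eq, map_neg, map_sup, map_neg, map_neg, neg_sup, neg_neg, neg_neg]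

end Complexification

end LatticeHomomorphisms

section FreeObject

variable {E : Type*} [NormedAddCommGroup E] [NormedSpace ℂ E]

namespace FBLC

theorem modulus_apply (f : FBLC E) (φ : StrongDual ℝ E) :
    f.modulus φ = ‖(f.re φ : ℂ) + Complex.I * (f.im φ : ℂ)‖ := by
  rw [← Complexification.modulus_real]
  exact (Complexification.modulus_map (S := LinearMap.proj φ ∘ₗ RenormedFBL.coeLinearMap)
    (fun _ _ => rfl) f).symm

theorem ofReal_norm (f : FBLC E) : ENNReal.ofReal ‖f‖ =
    cfblNorm (fun φ : StrongDual ℝ E => (f.re φ : ℂ) + Complex.I * (f.im φ : ℂ)) := by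
  rw [Complexification.norm_def, RenormedFBL.ofReal_norm]
  simp only [cfblNorm, tupleSup, modulus_apply, norm_norm]

end FBLC

theorem deltaReal_add (x y : E) : deltaReal (x + y) = deltaReal x + deltaReal y :=
  Subtype.ext (funext fun φ => map_add φ x y)

theorem deltaReal_real_smul (c : ℝ) (x : E) : deltaReal (c • x) = c • deltaReal x :=
  Subtype.ext (funext fun φ => map_smul φ c x)

theorem deltaReal_complex_smul (c : ℂ) (x : E) :
    deltaReal (c • x) = c.re • deltaReal x + c.im • deltaReal (Complex.I • x) := by
  have smul_eq : c • x = c.re • x + c.im • Complex.I • x := by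
    rw [← Complex.coe_smul, ← Complex.coe_smul, smul_smul, ← add_smul, Complex.re_add_im]
  rw [smul_eq, deltaReal_add, deltaReal_real_smul, deltaReal_real_smul]

theorem isLinearMap_deltaC : IsLinearMap ℂ (deltaC : E → FBLC E) where
  map_add x y := by
    refine Complexification.ext (deltaReal_add x y) ?_
    change -deltaReal (Complex.I • (x + y))
      = -deltaReal (Complex.I • x) + -deltaReal (Complex.I • y)
    rw [smul_add, deltaReal_add, neg_add]
  map_smul c x := by
    apply Complexification.ext
    · change deltaReal (c • x) = c.re • deltaReal x - c.im • -deltaReal (Complex.I • x)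
      rw [deltaReal_complex_smul, smul_neg, sub_neg_eq_add]
    · change -deltaReal (Complex.I • c • x)
        = c.re • -deltaReal (Complex.I • x) + c.im • deltaReal x
      rw [smul_smul, deltaReal_complex_smul]
      simp [add_comm]

theorem deltaC_apply_rePart (x : E) (z : StrongDual ℂ E) :
    ((deltaC x).re (rePart z) : ℂ) + Complex.I * ((deltaC x).im (rePart z) : ℂ) = z x := by
  have re_apply : (deltaC x).re (rePart z) = (z x).re := rfl
  have im_apply : (deltaC x).im (rePart z) = (z x).im := by
    change -(z (Complex.I • x)).re = (z x).im
    simp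
  rw [re_apply, im_apply, mul_comm, Complex.re_add_im]

theorem ofReal_norm_deltaC (x : E) :
    ENNReal.ofReal ‖deltaC x‖ = tupleSup (IsAdmissible ℂ E) fun z => z x := by
  simp only [FBLC.ofReal_norm, cfblNorm, deltaC_apply_rePart]

theorem tupleSup_isAdmissible_apply {𝕜 F : Type*} [RCLike 𝕜] [NormedAddCommGroup F]
    [NormedSpace 𝕜 F] (x : F) :
    tupleSup (IsAdmissible 𝕜 F) (fun z => z x) = ENNReal.ofReal ‖x‖ := by
  refine le_antisymm
    (tupleSup_le fun m z hz => ENNReal.ofReal_le_ofReal (hz.sum_norm_apply_le x)) ?_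
  obtain ⟨g, norm_g_le, apply_eq⟩ := exists_dual_vector'' 𝕜 x
  have admissible : IsAdmissible 𝕜 F 1 fun _ => g := fun y hy => by
    rw [Fin.sum_univ_one]
    exact (g.le_of_opNorm_le_of_le norm_g_le hy).trans_eq (one_mul 1)
  simpa [apply_eq] using le_tupleSup admissible fun z => z x

theorem isometry_deltaC : Isometry (deltaC : E → FBLC E) :=
  AddMonoidHomClass.isometry_of_norm isLinearMap_deltaC.mk' fun x =>
    (ENNReal.ofReal_eq_ofReal_iff (norm_nonneg _) (norm_nonneg _)).1
      ((ofReal_norm_deltaC x).trans (tupleSup_isAdmissible_apply x))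

theorem eq_of_isLatticeHom_of_comp_deltaC {X : Type*} [NormedAddCommGroup X] [NormedSpace ℝ X]
    [Lattice X] [IsOrderedAddMonoid X] [HasSolidNorm X]
    {R R' : FBLC E →ₗ[ℂ] Complexification X}
    (hR : Complexification.IsLatticeHom R) (hR' : Complexification.IsLatticeHom R')
    (h : ∀ z, R (deltaC z) = R' (deltaC z)) : R = R' := by
  obtain ⟨S, map_sup, -, R_apply⟩ := hR
  obtain ⟨S', map_sup', -, R'_apply⟩ := hR'
  have S_eq : S = S' := RenormedFBL.eq_of_map_sup map_sup map_sup' fun x => by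
    have re_eq := congrArg Complexification.re (h x)
    rwa [R_apply, R'_apply] at re_eq
  ext1 f
  rw [R_apply, R'_apply, S_eq]

variable {X : Type*} [NormedAddCommGroup X] [NormedSpace ℝ X] [Lattice X]
  [IsOrderedAddMonoid X] [IsOrderedModule ℝ X] [HasSolidNorm X] [CompleteSpace X]

theorem exists_isLatticeHom_extension (T : E →L[ℂ] Complexification X) :
    ∃ T' : FBLC E →L[ℂ] Complexification X,
      Complexification.IsLatticeHom (T' : FBLC E →ₗ[ℂ] Complexification X) ∧
      (∀ z, T' (deltaC z) = T z) ∧ ‖T'‖ ≤ ‖T‖ := by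
  obtain ⟨S, map_sup, apply_delta, norm_le⟩ := exists_map_sup_extension T
  have S_mono : Monotone S := Monotone.of_map_sup map_sup
  refine ⟨Complexification.complexify S S_mono,
    Complexification.isLatticeHom_complexify S_mono map_sup,
    fun z => Complexification.ext (apply_delta z) ?_,
    (Complexification.norm_complexify_le S S_mono).trans norm_le⟩
  change S (-deltaReal (Complex.I • z)) = (T z).im
  rw [map_neg, apply_delta, ← reOperator_apply, reOperator_I_smul, neg_neg]

theorem norm_le_norm_of_comp_deltaC {Y : Type*} [SeminormedAddCommGroup Y] [NormedSpace ℂ Y]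
    {T : E →L[ℂ] Y} {T' : FBLC E →L[ℂ] Y} (h : ∀ z, T' (deltaC z) = T z) : ‖T‖ ≤ ‖T'‖ :=
  T.opNorm_le_bound (norm_nonneg T') fun z => by
    rw [← h, ← isometry_deltaC.norm_map_of_map_zero isLinearMap_deltaC.map_zero z]
    exact T'.le_opNorm _

end FreeObject

theorem mainTheorem1_general (E : Type u) [NormedAddCommGroup E] [NormedSpace ℂ E] :
    IsFreeComplexBanachLattice.{u, u, w} E (RenormedFBL E) deltaC ∧
    ∀ f : FBLC E, ENNReal.ofReal ‖f‖ =
      cfblNorm (fun φ : StrongDual ℝ E => (f.re φ : ℂ) + Complex.I * (f.im φ : ℂ)) := by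
  refine ⟨⟨isLinearMap_deltaC, isometry_deltaC, ?_⟩, FBLC.ofReal_norm⟩
  intro X _ _ _ _ _ _ _ T
  obtain ⟨T', isLatticeHom, apply_delta, norm_le⟩ := exists_isLatticeHom_extension T
  refine ⟨T', isLatticeHom, apply_delta,
    norm_le.antisymm (norm_le_norm_of_comp_deltaC apply_delta), fun R hR hRδ f => ?_⟩
  have R_eq := eq_of_isLatticeHom_of_comp_deltaC hR isLatticeHom fun z =>
    (hRδ z).trans (apply_delta z).symm
  exact LinearMap.congr_fun R_eq f

/-- For a complex Banach space `E`, `FBL_ℂ[E]` together with `δ_E` is the free complex Banach lattice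
generated by `E`, and its norm is given by the explicit formula. -/
theorem mainTheorem1 (E : Type u) [NormedAddCommGroup E] [NormedSpace ℂ E]
    [CompleteSpace E] :
    IsFreeComplexBanachLattice.{u, u, w} E (RenormedFBL E) deltaC ∧
    ∀ f : FBLC E, ENNReal.ofReal ‖f‖ =
      cfblNorm (fun φ : StrongDual ℝ E => (f.re φ : ℂ) + Complex.I * (f.im φ : ℂ)) :=
  mainTheorem1_general E
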